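/- For $k\in\mathbb N$ let $\mathcal P_2(\mathbb R^k)$ be the set of Borel probability measures $\mu$ on $\mathbb R^k$ with $\int|x|^2\,\mu(dx)<\infty$. For probability measures $\mu,\nu$ on $\mathbb R^m$ let $$W_2(\mu,\nu)=\Big(\inf_{\pi\in\Pi(\mu,\nu)}\int\tfrac12|x-y|^2\,\pi(dx,dy)\Big)^{1/2},$$ where $\Pi(\mu,\nu)$ is the set of probability measures on $\mathbb R^m\times\mathbb R^m$ with first marginal $\mu$ and second marginal $\nu$. For $\theta$ in the unit sphere $\mathcal S^{k-1}$ of $\mathbb R^k$ let $\mu_\theta$ be the image of $\mu$ under $x\mapsto x^\top\theta$, and let $$SW_2(\mu,\nu)=\Big(\int_{\mathcal S^{k-1}}W_2(\mu_\theta,\nu_\theta)^2\,d\theta\Big)^{1/2},$$ where $d\theta$ is the uniform probability measure on $\mathcal S^{k-1}$. For $\sigma\ge0$ let $\mathcal N_\sigma$ be the normal distribution on $\mathbb R^k$ with mean $0$ and covariance matrix $\sigma^2I_k$ (the Dirac mass at $0$ if $\sigma=0$), and let $$SW_2^\sigma(\mu,\nu)=SW_2(\mu*\mathcal N_\sigma,\nu*\mathcal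 N_\sigma).$$ Then, for every $\sigma\ge0$, both $W_2$ and $SW_2^\sigma$ are (finite) metrics on $\mathcal P_2(\mathbb R^k)$, the metric space $(\mathcal P_2(\mathbb R^k),SW_2^\sigma)$ is complete, and $SW_2^\sigma$ induces on $\mathcal P_2(\mathbb R^k)$ the same topology as $W_2$. -/

import Mathlib

open MeasureTheory ProbabilityTheory
open scoped ENNReal

noncomputable section

/-- The set `Π(μ, ν)` of couplings of `μ` and `ν`: the probability measures on the product
with first marginal `μ` and second marginal `ν`. -/
def couplings {E : Type*} [MeasurableSpace E] (μ ν : Measure E) : Set (Measure (E × E)) :=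
  {π | IsProbabilityMeasure π ∧ π.map Prod.fst = μ ∧ π.map Prod.snd = ν}

/-- The 2-Wasserstein distance, with the cost `|x - y|² / 2`. It takes values in `[0, ∞]`, so
that no integrability has to be known for the definition to have its intended meaning. -/
def W2 {E : Type*} [NormedAddCommGroup E] [MeasurableSpace E] (μ ν : Measure E) : ℝ≥0∞ :=
  (⨅ π ∈ couplings μ ν, ∫⁻ z, ENNReal.ofReal (1 / 2 * ‖z.1 - z.2‖ ^ 2) ∂π) ^ (1 / 2 : ℝ)

/-- The push-forward `μ_θ` of `μ` under the projection `x ↦ xᵀ θ`. -/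
def proj {k : ℕ} (μ : Measure (EuclideanSpace ℝ (Fin k))) (θ : EuclideanSpace ℝ (Fin k)) :
    Measure ℝ :=
  μ.map (fun x => inner ℝ x θ)

/-- The uniform probability measure on the unit sphere of `ℝᵏ`, that is, the normalized surface
measure. -/
def sphereMeasure (k : ℕ) : Measure (Metric.sphere (0 : EuclideanSpace ℝ (Fin k)) 1) :=
  ((volume : Measure (EuclideanSpace ℝ (Fin k))).toSphere Set.univ)⁻¹ •
    (volume : Measure (EuclideanSpace ℝ (Fin k))).toSphere

/-- The sliced Wasserstein distance. -/
def SW2 {k : ℕ} (μ ν : Measure (EuclideanSpace ℝ (Fin k))) : ℝ≥0∞ :=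
  (∫⁻ θ, W2 (proj μ θ) (proj ν θ) ^ 2 ∂sphereMeasure k) ^ (1 / 2 : ℝ)

/-- The centred normal distribution on `ℝᵏ` with covariance matrix `σ² I`
(the Dirac mass at the origin if `σ = 0`). -/
def gaussianN (k : ℕ) (σ : ℝ) : Measure (EuclideanSpace ℝ (Fin k)) :=
  multivariateGaussian 0 (σ ^ 2 • (1 : Matrix (Fin k) (Fin k) ℝ))

/-- The Gaussian-regularized sliced Wasserstein distance. -/
def SW2reg {k : ℕ} (σ : ℝ) (μ ν : Measure (EuclideanSpace ℝ (Fin k))) : ℝ≥0∞ :=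
  SW2 (μ.conv (gaussianN k σ)) (ν.conv (gaussianN k σ))

/-- The set `P₂(ℝᵏ)` of Borel probability measures on `ℝᵏ` with finite second moment. -/
structure P2 (k : ℕ) where
  /-- The underlying measure. -/
  toMeasure : Measure (EuclideanSpace ℝ (Fin k))
  isProb : IsProbabilityMeasure toMeasure
  finite_moment : ∫⁻ x, ENNReal.ofReal (‖x‖ ^ 2) ∂toMeasure < ∞

end

/-
Averaging over directions gives the identity `k * SW2 μ δ₀ ^ 2 = (∫ ‖x‖²) / 2`: the sliced
distance to the origin controls, and determines, the second moment. A sequence bounded for the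
regularized distance is therefore tight, and has weakly convergent subsequences. As `SW2` is lower
semicontinuous under weak convergence, Cauchy sequences converge to such weak limits. If `μₙ`
converges to `μ` in the regularized distance, the limit of every such subsequence is `μ`, because
the characteristic function of the Gaussian has no zeros, and the identity shows that the second
moments of the convolutions converge. Hence so do those of `μₙ`, which together with weak
convergence gives convergence in `W2`.

Weak convergence with convergence of the second moments implies `W2`-convergence: convolving with
a mollifier moves the measures by little, and gives the convolutions densities that converge
pointwise, to which a Scheffé argument applies.
-/

open Filter Topology
open scoped NNReal

section Wasserstein

variable {Ω E F : Type*} [MeasurableSpace Ω] [NormedAddCommGroup E] [NormedAddCommGroup F]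

/-- The root mean square of `f` for the cost `|x|² / 2`, in which the Wasserstein distance is
measured. It is the `L²` norm for half the given measure, so that Minkowski's inequality
applies. -/
noncomputable def costNorm (f : Ω → E) (P : Measure Ω) : ℝ≥0∞ :=
  eLpNorm f 2 ((2⁻¹ : ℝ≥0∞) • P)

lemma costNorm_sq (f : Ω → E) (P : Measure Ω) :
    costNorm f P ^ 2 = 2⁻¹ * ∫⁻ ω, ‖f ω‖ₑ ^ 2 ∂P := by
  rw [costNorm, eLpNorm_eq_lintegral_rpow_enorm_toReal (by norm_num) (by norm_num),
    ← ENNReal.rpow_natCast, ← ENNReal.rpow_mul]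
  simp

lemma costNorm_eq_rpow (f : Ω → E) (P : Measure Ω) :
    costNorm f P = (∫⁻ ω, ENNReal.ofReal (1 / 2 * ‖f ω‖ ^ 2) ∂P) ^ (1 / 2 : ℝ) := by
  have hcost (x : E) : ENNReal.ofReal (1 / 2 * ‖x‖ ^ 2) = 2⁻¹ * ‖x‖ₑ ^ 2 := by
    rw [ENNReal.ofReal_mul (by norm_num), ENNReal.ofReal_pow (norm_nonneg _), ofReal_norm]
    simp
  simp_rw [hcost]
  rw [lintegral_const_mul' _ _ (by simp), ← costNorm_sq, ← ENNReal.rpow_natCast,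
    ← ENNReal.rpow_mul]
  simp

lemma costNorm_map {Ω' : Type*} [MeasurableSpace Ω'] {X : Ω → Ω'} {f : Ω' → E} {P : Measure Ω}
    (hf : StronglyMeasurable f) (hX : Measurable X) :
    costNorm f (P.map X) = costNorm (f ∘ X) P := by
  rw [costNorm, ← Measure.map_smul,
    eLpNorm_map_measure hf.aestronglyMeasurable hX.aemeasurable, costNorm]

lemma costNorm_mono_ae {f : Ω → E} {g : Ω → F} {P : Measure Ω} (h : ∀ᵐ ω ∂P, ‖f ω‖ ≤ ‖g ω‖) :
    costNorm f P ≤ costNorm g P :=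
  eLpNorm_mono_ae (Measure.ae_smul_measure h _)

lemma costNorm_sub_le {f g h : Ω → E} {P : Measure Ω} (hf : AEStronglyMeasurable f P)
    (hg : AEStronglyMeasurable g P) (hh : AEStronglyMeasurable h P) :
    costNorm (f - h) P ≤ costNorm (f - g) P + costNorm (g - h) P := by
  rw [← sub_add_sub_cancel f g h]
  exact eLpNorm_add_le ((hf.sub hg).smul_measure _) ((hg.sub hh).smul_measure _) (by norm_num)

variable [MeasurableSpace E] [MeasurableSpace F]

lemma W2_eq_iInf (μ ν : Measure E) :
    W2 μ ν = ⨅ π ∈ couplings μ ν, costNorm (Prod.fst - Prod.snd) π := by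
  have hcost (π : Measure (E × E)) : costNorm (Prod.fst - Prod.snd) π =
      (∫⁻ z, ENNReal.ofReal (1 / 2 * ‖z.1 - z.2‖ ^ 2) ∂π) ^ (1 / 2 : ℝ) :=
    costNorm_eq_rpow _ _
  simp_rw [hcost, W2]
  change ENNReal.orderIsoRpow (1 / 2) (by norm_num) _ = _
  simp only [OrderIso.map_iInf, ENNReal.orderIsoRpow_apply]

lemma W2_le_costNorm {μ ν : Measure E} {π : Measure (E × E)} (h : π ∈ couplings μ ν) :
    W2 μ ν ≤ costNorm (Prod.fst - Prod.snd) π := by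
  rw [W2_eq_iInf]
  exact iInf₂_le π h

lemma exists_costNorm_lt_of_W2_lt {μ ν : Measure E} {r : ℝ≥0∞} (h : W2 μ ν < r) :
    ∃ π ∈ couplings μ ν, costNorm (Prod.fst - Prod.snd) π < r := by
  rw [W2_eq_iInf] at h
  simpa only [iInf_lt_iff, exists_prop] using h

variable [BorelSpace E] [SecondCountableTopology E]

lemma W2_map_le {P : Measure Ω} [IsProbabilityMeasure P] {X Y : Ω → E}
    (hX : Measurable X) (hY : Measurable Y) :
    W2 (P.map X) (P.map Y) ≤ costNorm (X - Y) P := by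
  have hXY : Measurable fun ω => (X ω, Y ω) := hX.prodMk hY
  have hmem : P.map (fun ω => (X ω, Y ω)) ∈ couplings (P.map X) (P.map Y) := by
    refine ⟨Measure.isProbabilityMeasure_map hXY.aemeasurable, ?_, ?_⟩
    · rw [Measure.map_map measurable_fst hXY]; rfl
    · rw [Measure.map_map measurable_snd hXY]; rfl
  exact (W2_le_costNorm hmem).trans_eq
    (costNorm_map (measurable_fst.sub measurable_snd).stronglyMeasurable hXY)

omit [SecondCountableTopology E] in
lemma W2_map_le_W2 [BorelSpace F] [SecondCountableTopology F] {f : E → F}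
    (hf : LipschitzWith 1 f) (μ ν : Measure E) :
    W2 (μ.map f) (ν.map f) ≤ W2 μ ν := by
  have hfm : Measurable f := hf.continuous.measurable
  rw [W2_eq_iInf μ ν]
  refine le_iInf₂ fun π ⟨_, hfst, hsnd⟩ => ?_
  rw [← hfst, ← hsnd, Measure.map_map hfm measurable_fst, Measure.map_map hfm measurable_snd]
  refine (W2_map_le (hfm.comp measurable_fst) (hfm.comp measurable_snd)).trans
    (costNorm_mono_ae (ae_of_all _ fun z => ?_))
  simpa [dist_eq_norm] using hf.dist_le_mul z.1 z.2

lemma W2_self (μ : Measure E) [IsProbabilityMeasure μ] : W2 μ μ = 0 := by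
  simpa [costNorm] using W2_map_le (P := μ) measurable_id measurable_id

lemma W2_comm (μ ν : Measure E) : W2 μ ν = W2 ν μ := by
  suffices h : ∀ μ ν : Measure E, W2 ν μ ≤ W2 μ ν from le_antisymm (h ν μ) (h μ ν)
  intro μ ν
  rw [W2_eq_iInf μ ν]
  refine le_iInf₂ fun π ⟨_, hfst, hsnd⟩ => ?_
  rw [← hfst, ← hsnd]
  exact (W2_map_le measurable_snd measurable_fst).trans
    (costNorm_mono_ae (ae_of_all _ fun z => (norm_sub_rev z.2 z.1).le))

lemma exists_gluing {X Y Z : Type*} [MeasurableSpace X] [MeasurableSpace Y] [MeasurableSpace Z]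
    [StandardBorelSpace Z] [Nonempty Z] (π : Measure (X × Y)) [IsProbabilityMeasure π]
    (τ : Measure (Y × Z)) [IsProbabilityMeasure τ] (h : π.map Prod.snd = τ.map Prod.fst) :
    ∃ P : Measure ((X × Y) × Z), P.map Prod.fst = π ∧ P.map (Prod.map Prod.snd id) = τ := by
  refine ⟨π ⊗ₘ τ.condKernel.comap Prod.snd measurable_snd, Measure.fst_compProd _ _, ?_⟩
  conv_rhs => rw [← τ.disintegrate τ.condKernel, Measure.fst, ← h]
  refine Measure.ext_of_lintegral _ fun f hf => ?_
  rw [lintegral_map hf (by fun_prop), Measure.lintegral_compProd (by fun_prop),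
    Measure.lintegral_compProd hf, lintegral_map hf.lintegral_kernel_prod_right' measurable_snd]
  rfl

lemma W2_triangle [CompleteSpace E] (μ ν ρ : Measure E) : W2 μ ρ ≤ W2 μ ν + W2 ν ρ := by
  suffices h : ∀ π ∈ couplings μ ν, ∀ τ ∈ couplings ν ρ,
      W2 μ ρ ≤ costNorm (Prod.fst - Prod.snd) π + costNorm (Prod.fst - Prod.snd) τ by
    rw [W2_eq_iInf μ ν, W2_eq_iInf ν ρ]
    simp only [ENNReal.iInf_add, ENNReal.add_iInf]
    exact le_iInf₂ fun τ hτ => le_iInf₂ fun π hπ => h π hπ τ hτ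
  rintro π ⟨_, hπ₁, hπ₂⟩ τ ⟨_, hτ₁, hτ₂⟩
  obtain ⟨P, hPπ, hPτ⟩ := exists_gluing π τ (hπ₂.trans hτ₁.symm)
  have : IsProbabilityMeasure P :=
    (Measure.isProbabilityMeasure_map_iff measurable_fst.aemeasurable).1
      (by rw [hPπ]; infer_instance)
  have hX : Measurable fun z : (E × E) × E => z.1.1 := by fun_prop
  have hY : Measurable fun z : (E × E) × E => z.1.2 := by fun_prop
  have hμ : P.map (fun z => z.1.1) = μ := by
    rw [← hπ₁, ← hPπ, Measure.map_map measurable_fst measurable_fst]; rfl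
  have hρ : P.map Prod.snd = ρ := by
    rw [← hτ₂, ← hPτ, Measure.map_map measurable_snd (by fun_prop)]; rfl
  have hsub : StronglyMeasurable (Prod.fst - Prod.snd : E × E → E) :=
    (measurable_fst.sub measurable_snd).stronglyMeasurable
  rw [← hμ, ← hρ]
  refine (W2_map_le hX measurable_snd).trans ((costNorm_sub_le hX.aestronglyMeasurable
    hY.aestronglyMeasurable measurable_snd.aestronglyMeasurable).trans_eq ?_)
  rw [← hPπ, ← hPτ, costNorm_map hsub measurable_fst, costNorm_map hsub (by fun_prop)]
  rfl

lemma W2_conv_le (μ ν ρ : Measure E) [IsProbabilityMeasure ρ] :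
    W2 (μ.conv ρ) (ν.conv ρ) ≤ W2 μ ν := by
  rw [W2_eq_iInf μ ν]
  refine le_iInf₂ fun π ⟨_, hfst, hsnd⟩ => ?_
  have hconv {p : E × E → E} (hp : Measurable p) :
      (π.prod ρ).map (fun z => p z.1 + z.2) = (π.map p).conv ρ := by
    have := Measure.isProbabilityMeasure_map (μ := π) hp.aemeasurable
    rw [Measure.conv, ← Measure.map_id (μ := ρ), Measure.map_prod_map _ _ hp measurable_id,
      Measure.map_map (by fun_prop) (by fun_prop), Measure.map_id]
    rfl
  rw [← hfst, ← hsnd, ← hconv measurable_fst, ← hconv measurable_snd]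
  refine (W2_map_le (by fun_prop) (by fun_prop)).trans_eq ?_
  have hπ : (π.prod ρ).map Prod.fst = π := by simp
  conv_rhs => rw [← hπ, costNorm_map (measurable_fst.sub measurable_snd).stronglyMeasurable
    measurable_fst]
  congr 1
  ext z
  simp

lemma W2_self_conv_le (μ ρ : Measure E) [IsProbabilityMeasure μ] [IsProbabilityMeasure ρ] :
    W2 μ (μ.conv ρ) ≤ W2 (Measure.dirac 0) ρ := by
  have h := W2_conv_le (Measure.dirac 0) ρ μ
  rwa [Measure.dirac_zero_conv, Measure.conv_comm ρ μ] at h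

/-- The second moment of `μ` about the origin. It is `[0, ∞]`-valued, so that being in `P₂` is
expressed by `secondMoment μ ≠ ∞`. -/
noncomputable def secondMoment (μ : Measure E) : ℝ≥0∞ :=
  ∫⁻ x, ‖x‖ₑ ^ 2 ∂μ

lemma W2_dirac_zero_sq (μ : Measure E) [IsProbabilityMeasure μ] :
    W2 μ (Measure.dirac 0) ^ 2 = 2⁻¹ * secondMoment μ := by
  suffices h : W2 μ (Measure.dirac 0) = costNorm id μ by rw [h, costNorm_sq]; rfl
  refine le_antisymm ?_ ?_
  · have h := W2_map_le (P := μ) measurable_id (measurable_const (a := (0 : E)))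
    rw [Measure.map_id, Measure.map_const, measure_univ, one_smul] at h
    exact h.trans_eq (congrArg (costNorm · μ) (sub_zero id))
  · rw [W2_eq_iInf]
    refine le_iInf₂ fun π ⟨_, hfst, hsnd⟩ => ?_
    have hzero : ∀ᵐ z ∂π, z.2 = 0 := by
      have h : ∀ᵐ y ∂π.map Prod.snd, y = 0 := by
        rw [hsnd, ae_dirac_eq]
        rfl
      exact ae_of_ae_map measurable_snd.aemeasurable h
    rw [← hfst, costNorm_map (by fun_prop) measurable_fst]
    refine costNorm_mono_ae ?_
    filter_upwards [hzero] with z hz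
    simp [hz]

lemma W2_dirac_zero_ne_top {μ : Measure E} [IsProbabilityMeasure μ] (h : secondMoment μ ≠ ∞) :
    W2 μ (Measure.dirac 0) ≠ ∞ := by
  have hsq : W2 μ (Measure.dirac 0) ^ 2 ≠ ∞ := by
    rw [W2_dirac_zero_sq]
    exact ENNReal.mul_ne_top (by simp) h
  exact fun htop => hsq (by simp [htop])

lemma W2_ne_top [CompleteSpace E] {μ ν : Measure E} [IsProbabilityMeasure μ]
    [IsProbabilityMeasure ν] (hμ : secondMoment μ ≠ ∞) (hν : secondMoment ν ≠ ∞) : W2 μ ν ≠ ∞ := by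
  refine ne_top_of_le_ne_top ?_ (W2_triangle μ (Measure.dirac 0) ν)
  rw [W2_comm _ ν]
  exact ENNReal.add_ne_top.2 ⟨W2_dirac_zero_ne_top hμ, W2_dirac_zero_ne_top hν⟩

end Wasserstein

section WeakConvergence

section LowerSemicontinuity

variable {X : Type*} [TopologicalSpace X] [MeasurableSpace X] [OpensMeasurableSpace X]
  [HasOuterApproxClosed X] {μs : ℕ → ProbabilityMeasure X} {μ : ProbabilityMeasure X}

lemma lintegral_le_liminf_of_tendsto (h : Tendsto μs atTop (𝓝 μ)) {f : X → ℝ≥0}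
    (hf : Continuous f) :
    ∫⁻ x, f x ∂(μ : Measure X) ≤ atTop.liminf fun n => ∫⁻ x, f x ∂(μs n : Measure X) := by
  simpa only [ENNReal.ofReal_coe_nnreal] using
    lintegral_le_liminf_lintegral_of_forall_isOpen_measure_le_liminf_measure
      (f := fun x => (f x : ℝ)) (by fun_prop) (fun x => (f x).2)
      fun _ hG => ProbabilityMeasure.le_liminf_measure_open_of_tendsto h hG

/- `∫ g` and `∫ (f - g)` are both lower semicontinuous, and their sum converges. -/
lemma tendsto_lintegral_of_le (h : Tendsto μs atTop (𝓝 μ)) {f g : X → ℝ≥0}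
    (hf : Continuous f) (hg : Continuous g) (hgf : g ≤ f)
    (hlim : Tendsto (fun n => ∫⁻ x, f x ∂(μs n : Measure X)) atTop
      (𝓝 (∫⁻ x, f x ∂(μ : Measure X))))
    (hfin : ∫⁻ x, f x ∂(μ : Measure X) ≠ ∞) :
    Tendsto (fun n => ∫⁻ x, g x ∂(μs n : Measure X)) atTop
      (𝓝 (∫⁻ x, g x ∂(μ : Measure X))) := by
  have hsplit (ν : Measure X) : ∫⁻ x, g x ∂ν + ∫⁻ x, (f x - g x : ℝ≥0) ∂ν = ∫⁻ x, f x ∂ν := by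
    rw [← lintegral_add_left (by fun_prop)]
    exact lintegral_congr fun x => by rw [← ENNReal.coe_add, add_tsub_cancel_of_le (hgf x)]
  have hfin' : ∫⁻ x, (f x - g x : ℝ≥0) ∂(μ : Measure X) ≠ ∞ :=
    ne_top_of_le_ne_top hfin (le_add_self.trans_eq (hsplit μ))
  refine tendsto_of_le_liminf_of_limsup_le (lintegral_le_liminf_of_tendsto h hg) ?_
  refine (ENNReal.add_le_add_iff_right hfin').1 ?_
  calc atTop.limsup (fun n => ∫⁻ x, g x ∂(μs n : Measure X)) +
        ∫⁻ x, (f x - g x : ℝ≥0) ∂(μ : Measure X)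
    _ ≤ atTop.limsup (fun n => ∫⁻ x, g x ∂(μs n : Measure X)) +
          atTop.liminf (fun n => ∫⁻ x, (f x - g x : ℝ≥0) ∂(μs n : Measure X)) := by
        gcongr
        exact lintegral_le_liminf_of_tendsto h (by fun_prop)
    _ ≤ atTop.limsup (fun n => ∫⁻ x, f x ∂(μs n : Measure X)) := by
        rw [liminf_eq, ENNReal.add_sSup ⟨0, by simp⟩]
        refine iSup₂_le fun c hc => ?_
        rw [← limsup_add_const _ _ _ (by isBoundedDefault) (by isBoundedDefault)]
        exact limsup_le_limsup
          (hc.mono fun n hn => (add_le_add_right hn _).trans_eq (hsplit _))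
    _ = ∫⁻ x, g x ∂(μ : Measure X) + ∫⁻ x, (f x - g x : ℝ≥0) ∂(μ : Measure X) := by
        rw [hlim.limsup_eq, hsplit]

end LowerSemicontinuity

section Couplings

variable {E : Type*} [NormedAddCommGroup E] [MeasurableSpace E] [BorelSpace E]
  [SecondCountableTopology E] [CompleteSpace E]
  {μs νs : ℕ → ProbabilityMeasure E} {μ ν : ProbabilityMeasure E}

lemma isTightMeasureSet_range_of_tendsto (h : Tendsto μs atTop (𝓝 μ)) :
    IsTightMeasureSet (Set.range fun n => (μs n : Measure E)) := by
  have hcomp : IsCompact (closure (insert μ (Set.range μs))) :=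
    (h.isCompact_insert_range.isClosed.closure_eq).symm ▸ h.isCompact_insert_range
  refine (isTightMeasureSet_of_isCompact_closure hcomp).subset ?_
  rintro _ ⟨n, rfl⟩
  exact ⟨μs n, Or.inr ⟨n, rfl⟩, rfl⟩

lemma exists_subseq_tendsto_of_mem_couplings (hμ : Tendsto μs atTop (𝓝 μ))
    (hν : Tendsto νs atTop (𝓝 ν)) {πs : ℕ → ProbabilityMeasure (E × E)}
    (hπs : ∀ n, (πs n : Measure (E × E)) ∈ couplings (μs n : Measure E) (νs n)) :
    ∃ (π : ProbabilityMeasure (E × E)) (φ : ℕ → ℕ), StrictMono φ ∧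
      (π : Measure (E × E)) ∈ couplings (μ : Measure E) ν ∧ Tendsto (πs ∘ φ) atTop (𝓝 π) := by
  have htight : IsTightMeasureSet
      {((ϖ : ProbabilityMeasure (E × E)) : Measure (E × E)) | ϖ ∈ Set.range πs} := by
    refine .prodMk ((isTightMeasureSet_range_of_tendsto hμ).subset ?_)
      ((isTightMeasureSet_range_of_tendsto hν).subset ?_)
    · rintro _ ⟨_, ⟨_, ⟨n, rfl⟩, rfl⟩, rfl⟩
      exact ⟨n, (hπs n).2.1.symm⟩
    · rintro _ ⟨_, ⟨_, ⟨n, rfl⟩, rfl⟩, rfl⟩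
      exact ⟨n, (hπs n).2.2.symm⟩
  obtain ⟨π, -, φ, hφ, hπ⟩ := (isCompact_closure_of_isTightMeasureSet htight).tendsto_subseq
    (x := πs) fun n => subset_closure (Set.mem_range_self n)
  have hmarginal {p : E × E → E} (hp : Continuous p) {ρs : ℕ → ProbabilityMeasure E}
      {ρ : ProbabilityMeasure E} (hρ : Tendsto ρs atTop (𝓝 ρ))
      (h : ∀ n, (πs n : Measure (E × E)).map p = ρs n) : (π : Measure (E × E)).map p = ρ := by
    have hlim := ProbabilityMeasure.tendsto_map_of_tendsto_of_continuous _ _ hπ hp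
    have hmap : (fun n => ((πs ∘ φ) n).map hp.measurable.aemeasurable) = ρs ∘ φ :=
      funext fun n => Subtype.ext (h (φ n))
    rw [hmap] at hlim
    exact congrArg ProbabilityMeasure.toMeasure
      (tendsto_nhds_unique hlim (hρ.comp hφ.tendsto_atTop))
  exact ⟨π, φ, hφ, ⟨π.2, hmarginal continuous_fst hμ fun n => (hπs n).2.1,
    hmarginal continuous_snd hν fun n => (hπs n).2.2⟩, hπ⟩

omit [CompleteSpace E] in
lemma costNorm_le_liminf_of_tendsto {πs : ℕ → ProbabilityMeasure (E × E)}
    {π : ProbabilityMeasure (E × E)} (h : Tendsto πs atTop (𝓝 π)) :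
    costNorm (Prod.fst - Prod.snd) (π : Measure (E × E)) ≤
      atTop.liminf fun n => costNorm (Prod.fst - Prod.snd) (πs n : Measure (E × E)) := by
  have hcont : Continuous fun z : E × E => 2⁻¹ * ‖z.1 - z.2‖₊ ^ 2 := by fun_prop
  have hcost (ϖ : Measure (E × E)) : costNorm (Prod.fst - Prod.snd) ϖ =
      ENNReal.orderIsoRpow (1 / 2) (by norm_num)
        (∫⁻ z, (2⁻¹ * ‖z.1 - z.2‖₊ ^ 2 : ℝ≥0) ∂ϖ) := by
    rw [costNorm_eq_rpow, ENNReal.orderIsoRpow_apply]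
    congr 1
    refine lintegral_congr fun z => ?_
    rw [← ENNReal.ofReal_coe_nnreal]
    simp
  simp_rw [hcost]
  rw [← OrderIso.liminf_apply]
  exact (ENNReal.orderIsoRpow (1 / 2) _).monotone (lintegral_le_liminf_of_tendsto h hcont)

omit [BorelSpace E] [SecondCountableTopology E] [CompleteSpace E] in
lemma exists_coupling_costNorm_le (μ ν : Measure E) [IsProbabilityMeasure μ]
    [IsProbabilityMeasure ν] {ε : ℝ≥0∞} (hε : ε ≠ 0) :
    ∃ π ∈ couplings μ ν, costNorm (Prod.fst - Prod.snd) π ≤ W2 μ ν + ε := by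
  rcases eq_or_ne (W2 μ ν) ∞ with htop | hfin
  · exact ⟨μ.prod ν, ⟨inferInstance, by simp, by simp⟩, by simp [htop]⟩
  · obtain ⟨π, hπ, hlt⟩ := exists_costNorm_lt_of_W2_lt (ENNReal.lt_add_right hfin hε)
    exact ⟨π, hπ, hlt.le⟩

theorem exists_coupling_costNorm_le_liminf (hμ : Tendsto μs atTop (𝓝 μ))
    (hν : Tendsto νs atTop (𝓝 ν)) :
    ∃ π ∈ couplings (μ : Measure E) ν, costNorm (Prod.fst - Prod.snd) π ≤
      atTop.liminf fun n => W2 (μs n : Measure E) (νs n) := by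
  have happrox (n : ℕ) : ∃ π ∈ couplings (μs n : Measure E) (νs n),
      costNorm (Prod.fst - Prod.snd) π ≤ W2 (μs n : Measure E) (νs n) + (n : ℝ≥0∞)⁻¹ :=
    exists_coupling_costNorm_le _ _ (by simp)
  choose πs hπs hcost using happrox
  obtain ⟨u, hW2, hu⟩ := exists_seq_tendsto_liminf (f := atTop)
    (u := fun n => W2 (μs n : Measure E) (νs n))
  obtain ⟨π, φ, hφ, hπ, hlim⟩ := exists_subseq_tendsto_of_mem_couplings (hμ.comp hu)
    (hν.comp hu) (πs := fun n => ⟨πs (u n), (hπs (u n)).1⟩) fun n => hπs (u n)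
  have huφ : Tendsto (u ∘ φ) atTop atTop := hu.comp hφ.tendsto_atTop
  have hbound := (hW2.comp hφ.tendsto_atTop).add (ENNReal.tendsto_inv_nat_nhds_zero.comp huφ)
  rw [add_zero] at hbound
  refine ⟨π, hπ, (costNorm_le_liminf_of_tendsto hlim).trans ?_⟩
  rw [← hbound.liminf_eq]
  exact liminf_le_liminf (Eventually.of_forall fun n => hcost (u (φ n)))

lemma W2_le_liminf (hμ : Tendsto μs atTop (𝓝 μ)) (hν : Tendsto νs atTop (𝓝 ν)) :
    W2 (μ : Measure E) ν ≤ atTop.liminf fun n => W2 (μs n : Measure E) (νs n) := by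
  obtain ⟨π, hπ, hle⟩ := exists_coupling_costNorm_le_liminf hμ hν
  exact (W2_le_costNorm hπ).trans hle

lemma exists_optimal_coupling (μ ν : Measure E) [IsProbabilityMeasure μ]
    [IsProbabilityMeasure ν] :
    ∃ π ∈ couplings μ ν, costNorm (Prod.fst - Prod.snd) π = W2 μ ν := by
  obtain ⟨π, hπ, hle⟩ := exists_coupling_costNorm_le_liminf (E := E) (μ := ⟨μ, ‹_›⟩)
    (ν := ⟨ν, ‹_›⟩) tendsto_const_nhds tendsto_const_nhds
  exact ⟨π, hπ, le_antisymm (hle.trans_eq (liminf_const _)) (W2_le_costNorm hπ)⟩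

lemma eq_of_W2_eq_zero {μ ν : Measure E} [IsProbabilityMeasure μ] [IsProbabilityMeasure ν]
    (h : W2 μ ν = 0) : μ = ν := by
  obtain ⟨π, ⟨_, hfst, hsnd⟩, hπ⟩ := exists_optimal_coupling μ ν
  have hcost : ∫⁻ z : E × E, ‖z.1 - z.2‖ₑ ^ 2 ∂π = 0 := by
    have hsq := costNorm_sq (Prod.fst - Prod.snd) π
    rw [hπ, h] at hsq
    simpa [-lintegral_eq_zero_iff] using hsq.symm
  have hdiag : Prod.fst =ᵐ[π] Prod.snd := by
    rw [lintegral_eq_zero_iff (by fun_prop)] at hcost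
    filter_upwards [hcost] with z hz
    simpa [sub_eq_zero] using hz
  rw [← hfst, ← hsnd, Measure.map_congr hdiag]

end Couplings

end WeakConvergence

lemma nnnorm_add_sq_le {E : Type*} [SeminormedAddCommGroup E] (x y : E) :
    ‖x + y‖₊ ^ 2 ≤ 2 * (‖x‖₊ ^ 2 + ‖y‖₊ ^ 2) :=
  (pow_le_pow_left' (nnnorm_add_le x y) 2).trans add_sq_le

lemma enorm_add_sq_le {E : Type*} [SeminormedAddCommGroup E] (x y : E) :
    ‖x + y‖ₑ ^ 2 ≤ 2 * (‖x‖ₑ ^ 2 + ‖y‖ₑ ^ 2) := by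
  simp only [enorm_eq_nnnorm]
  exact_mod_cast nnnorm_add_sq_le x y

section Density

section ExcessTransport

variable {E : Type*} [NormedAddCommGroup E] [MeasurableSpace E]

lemma lintegral_prod_enorm_sub_sq_le [OpensMeasurableSpace E] (α β : Measure E)
    [IsFiniteMeasure β] :
    2⁻¹ * ∫⁻ z, ‖z.1 - z.2‖ₑ ^ 2 ∂α.prod β ≤
      secondMoment α * β .univ + secondMoment β * α .univ := by
  have hbound (x y : E) : 2⁻¹ * ‖x - y‖ₑ ^ 2 ≤ ‖x‖ₑ ^ 2 + ‖y‖ₑ ^ 2 := by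
    rw [ENNReal.inv_mul_le_iff (by simp) (by simp)]
    simpa [sub_eq_add_neg] using enorm_add_sq_le x (-y)
  calc 2⁻¹ * ∫⁻ z, ‖z.1 - z.2‖ₑ ^ 2 ∂α.prod β
    _ = ∫⁻ z, 2⁻¹ * ‖z.1 - z.2‖ₑ ^ 2 ∂α.prod β := (lintegral_const_mul' _ _ (by simp)).symm
    _ ≤ ∫⁻ z, (‖z.1‖ₑ ^ 2 + ‖z.2‖ₑ ^ 2) ∂α.prod β := lintegral_mono fun z => hbound z.1 z.2
    _ = secondMoment α * β .univ + secondMoment β * α .univ := by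
        have hsq : AEMeasurable (fun x : E => ‖x‖ₑ ^ 2) α := by fun_prop
        have hsq' : AEMeasurable (fun x : E => ‖x‖ₑ ^ 2) β := by fun_prop
        rw [lintegral_add_left' hsq.comp_fst, lintegral_prod _ hsq.comp_fst,
          lintegral_prod _ hsq'.comp_snd]
        simp only [lintegral_const]
        rw [lintegral_mul_const' _ _ (measure_ne_top β _)]
        rfl

variable [BorelSpace E] [SecondCountableTopology E]

/- The common part `γ` stays where it is, and the excess `α` is transported to `β` by the
normalized product coupling. -/
lemma W2_add_sq_le (γ α β : Measure E) [IsProbabilityMeasure (γ + α)]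
    [IsProbabilityMeasure (γ + β)] :
    W2 (γ + α) (γ + β) ^ 2 ≤ secondMoment α + secondMoment β := by
  have : IsFiniteMeasure γ := isFiniteMeasure_of_le (γ + α) (Measure.le_add_right le_rfl)
  have : IsFiniteMeasure α := isFiniteMeasure_of_le (γ + α) (Measure.le_add_left le_rfl)
  have : IsFiniteMeasure β := isFiniteMeasure_of_le (γ + β) (Measure.le_add_left le_rfl)
  have hmass : α .univ = β .univ := by
    have h : (γ + α) .univ = (γ + β) .univ := by simp only [measure_univ]
    exact (ENNReal.add_right_inj (measure_ne_top γ .univ)).1 h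
  rcases eq_or_ne (α .univ) 0 with hα | hα
  · obtain rfl : α = 0 := Measure.measure_univ_eq_zero.1 hα
    obtain rfl : β = 0 := Measure.measure_univ_eq_zero.1 (hmass ▸ hα)
    simp only [W2_self, ne_eq, OfNat.ofNat_ne_zero, not_false_eq_true, zero_pow, zero_le]
  have hinv : (α .univ)⁻¹ * α .univ = 1 := ENNReal.inv_mul_cancel hα (measure_ne_top _ _)
  have hdiag : Measurable fun x : E => (x, x) := by fun_prop
  let π := γ.map (fun x => (x, x)) + (α .univ)⁻¹ • α.prod β
  have hfst : π.map Prod.fst = γ + α := by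
    rw [Measure.map_add _ _ measurable_fst, Measure.map_map measurable_fst hdiag,
      Measure.map_smul, Measure.map_fst_prod, smul_smul, ← hmass, hinv, one_smul]
    exact congrArg (· + α) Measure.map_id
  have hsnd : π.map Prod.snd = γ + β := by
    rw [Measure.map_add _ _ measurable_snd, Measure.map_map measurable_snd hdiag,
      Measure.map_smul, Measure.map_snd_prod, smul_smul, hinv, one_smul]
    exact congrArg (· + β) Measure.map_id
  have hπ : π ∈ couplings (γ + α) (γ + β) := by
    refine ⟨?_, hfst, hsnd⟩
    rw [← Measure.isProbabilityMeasure_map_iff measurable_fst.aemeasurable, hfst]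
    infer_instance
  calc W2 (γ + α) (γ + β) ^ 2
    _ ≤ costNorm (Prod.fst - Prod.snd) π ^ 2 := pow_le_pow_left' (W2_le_costNorm hπ) 2
    _ = (α .univ)⁻¹ * (2⁻¹ * ∫⁻ z, ‖z.1 - z.2‖ₑ ^ 2 ∂α.prod β) := by
        simp only [costNorm_sq, Pi.sub_apply]
        rw [lintegral_add_measure, lintegral_smul_measure, lintegral_map (by fun_prop) hdiag]
        simp [mul_left_comm]
    _ ≤ (α .univ)⁻¹ * (α .univ * (secondMoment α + secondMoment β)) := by
        refine mul_le_mul' le_rfl ?_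
        rw [mul_comm (α .univ), add_mul]
        nth_rw 1 [hmass]
        exact lintegral_prod_enorm_sub_sq_le α β
    _ = secondMoment α + secondMoment β := by rw [← mul_assoc, hinv, one_mul]

lemma W2_withDensity_sq_le (κ : Measure E) {f g : E → ℝ≥0∞} (hf : Measurable f)
    (hg : Measurable g) [IsProbabilityMeasure (κ.withDensity f)]
    [IsProbabilityMeasure (κ.withDensity g)] :
    W2 (κ.withDensity f) (κ.withDensity g) ^ 2 ≤
      secondMoment (κ.withDensity (f - g)) + secondMoment (κ.withDensity (g - f)) := by
  have hsplit {f g : E → ℝ≥0∞} (hf : Measurable f) (hg : Measurable g) :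
      κ.withDensity f = κ.withDensity (f ⊓ g) + κ.withDensity (f - g) := by
    rw [← withDensity_add_left (hf.inf hg)]
    congr 1
    ext x
    exact (add_comm _ _).trans tsub_add_min |>.symm
  have hf' := hsplit hf hg
  have hg' := inf_comm f g ▸ hsplit hg hf
  have : IsProbabilityMeasure (κ.withDensity (f ⊓ g) + κ.withDensity (f - g)) := hf' ▸ ‹_›
  have : IsProbabilityMeasure (κ.withDensity (f ⊓ g) + κ.withDensity (g - f)) := hg' ▸ ‹_›
  nth_rw 1 [hf', hg']
  exact W2_add_sq_le _ _ _

end ExcessTransport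

section Scheffe

variable {X : Type*} [MeasurableSpace X] {κ : Measure X} {fs : ℕ → X → ℝ≥0∞} {f : X → ℝ≥0∞}

lemma tendsto_lintegral_sub_left (hfs : ∀ n, Measurable (fs n)) (hf : Measurable f)
    (hlim : ∀ᵐ x ∂κ, Tendsto (fun n => fs n x) atTop (𝓝 (f x))) (hfin : ∫⁻ x, f x ∂κ ≠ ∞) :
    Tendsto (fun n => ∫⁻ x, (f - fs n) x ∂κ) atTop (𝓝 0) := by
  rw [← lintegral_zero (μ := κ)]
  refine tendsto_lintegral_of_dominated_convergence f (fun n => hf.sub (hfs n))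
    (fun n => ae_of_all _ fun x => tsub_le_self) hfin ?_
  filter_upwards [hlim, ae_lt_top hf hfin] with x hx hfx
  have h := ENNReal.Tendsto.sub tendsto_const_nhds hx (.inl hfx.ne)
  rwa [tsub_self] at h

lemma tendsto_lintegral_sub_right (hfs : ∀ n, Measurable (fs n)) (hf : Measurable f)
    (hlim : ∀ᵐ x ∂κ, Tendsto (fun n => fs n x) atTop (𝓝 (f x))) (hfin : ∫⁻ x, f x ∂κ ≠ ∞)
    (hint : Tendsto (fun n => ∫⁻ x, fs n x ∂κ) atTop (𝓝 (∫⁻ x, f x ∂κ))) :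
    Tendsto (fun n => ∫⁻ x, (fs n - f) x ∂κ) atTop (𝓝 0) := by
  have hsplit (n : ℕ) : ∫⁻ x, (fs n - f) x ∂κ =
      ∫⁻ x, fs n x ∂κ + ∫⁻ x, (f - fs n) x ∂κ - ∫⁻ x, f x ∂κ := by
    rw [← lintegral_add_left (hfs n)]
    refine ENNReal.eq_sub_of_add_eq hfin ?_
    rw [← lintegral_add_right _ hf]
    refine lintegral_congr fun x => ?_
    simp [tsub_add_eq_max, add_tsub_eq_max]
  have h := ENNReal.Tendsto.sub (hint.add (tendsto_lintegral_sub_left hfs hf hlim hfin))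
    tendsto_const_nhds (.inr hfin)
  rw [add_zero, tsub_self] at h
  exact h.congr fun n => (hsplit n).symm

end Scheffe

section WeightedScheffe

variable {E : Type*} [NormedAddCommGroup E] [MeasurableSpace E] [BorelSpace E]

lemma secondMoment_withDensity (κ : Measure E) {f : E → ℝ≥0∞} (hf : Measurable f) :
    secondMoment (κ.withDensity f) = ∫⁻ x, f x ∂κ.withDensity fun x => ‖x‖ₑ ^ 2 := by
  rw [secondMoment, lintegral_withDensity_eq_lintegral_mul _ hf (by fun_prop),
    lintegral_withDensity_eq_lintegral_mul _ (by fun_prop) hf, mul_comm]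

variable [SecondCountableTopology E]

lemma tendsto_W2_withDensity (κ : Measure E) {fs : ℕ → E → ℝ≥0∞} {f : E → ℝ≥0∞}
    (hfs : ∀ n, Measurable (fs n)) (hf : Measurable f)
    [∀ n, IsProbabilityMeasure (κ.withDensity (fs n))] [IsProbabilityMeasure (κ.withDensity f)]
    (hlim : ∀ᵐ x ∂κ, Tendsto (fun n => fs n x) atTop (𝓝 (f x)))
    (hfin : secondMoment (κ.withDensity f) ≠ ∞)
    (hmom : Tendsto (fun n => secondMoment (κ.withDensity (fs n))) atTop
      (𝓝 (secondMoment (κ.withDensity f)))) :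
    Tendsto (fun n => W2 (κ.withDensity (fs n)) (κ.withDensity f)) atTop (𝓝 0) := by
  simp_rw [secondMoment_withDensity κ hf, secondMoment_withDensity κ (hfs _)] at hfin hmom
  have hlim' := (withDensity_absolutelyContinuous κ fun x => ‖x‖ₑ ^ 2).ae_le hlim
  have hsum := (tendsto_lintegral_sub_right hfs hf hlim' hfin hmom).add
    (tendsto_lintegral_sub_left hfs hf hlim' hfin)
  rw [add_zero] at hsum
  have hsq : Tendsto (fun n => W2 (κ.withDensity (fs n)) (κ.withDensity f) ^ 2) atTop (𝓝 0) := by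
    refine tendsto_of_tendsto_of_tendsto_of_le_of_le tendsto_const_nhds hsum
      (fun _ => zero_le) fun n => ?_
    rw [← secondMoment_withDensity κ ((hfs n).sub hf),
      ← secondMoment_withDensity κ (hf.sub (hfs n))]
    exact W2_withDensity_sq_le κ (hfs n) hf
  have hsqrt := hsq.ennrpow_const (1 / 2 : ℝ)
  simp_rw [← ENNReal.rpow_natCast, ← ENNReal.rpow_mul] at hsqrt
  simpa using hsqrt

end WeightedScheffe

end Density

section Smoothing

section SecondMomentConv

variable {E : Type*} [NormedAddCommGroup E] [MeasurableSpace E] [BorelSpace E]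
  [SecondCountableTopology E]

lemma secondMoment_conv (μ ρ : Measure E) :
    secondMoment (μ.conv ρ) = ∫⁻ z, ‖z.1 + z.2‖ₑ ^ 2 ∂μ.prod ρ := by
  rw [secondMoment, Measure.conv, lintegral_map (by fun_prop) (by fun_prop)]

omit [SecondCountableTopology E] in
lemma lintegral_enorm_fst_sq (μ ρ : Measure E) [IsProbabilityMeasure ρ] :
    ∫⁻ z, ‖z.1‖ₑ ^ 2 ∂μ.prod ρ = secondMoment μ :=
  measurePreserving_fst.lintegral_comp (f := fun x => ‖x‖ₑ ^ 2) (by fun_prop)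

omit [SecondCountableTopology E] in
lemma lintegral_enorm_snd_sq (μ ρ : Measure E) [IsProbabilityMeasure μ] [SFinite ρ] :
    ∫⁻ z, ‖z.2‖ₑ ^ 2 ∂μ.prod ρ = secondMoment ρ :=
  measurePreserving_snd.lintegral_comp (f := fun x => ‖x‖ₑ ^ 2) (by fun_prop)

omit [SecondCountableTopology E] in
lemma lintegral_two_mul_enorm_sq_add (μ ρ : Measure E) [IsProbabilityMeasure μ]
    [IsProbabilityMeasure ρ] :
    ∫⁻ z, 2 * (‖z.1‖ₑ ^ 2 + ‖z.2‖ₑ ^ 2) ∂μ.prod ρ = 2 * (secondMoment μ + secondMoment ρ) := by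
  rw [lintegral_const_mul _ (by fun_prop), lintegral_add_left (by fun_prop),
    lintegral_enorm_fst_sq, lintegral_enorm_snd_sq]

lemma secondMoment_conv_ne_top {μ ρ : Measure E} [IsProbabilityMeasure μ]
    [IsProbabilityMeasure ρ] (hμ : secondMoment μ ≠ ∞) (hρ : secondMoment ρ ≠ ∞) :
    secondMoment (μ.conv ρ) ≠ ∞ := by
  rw [secondMoment_conv]
  refine ne_top_of_le_ne_top ?_ (lintegral_mono fun z => enorm_add_sq_le z.1 z.2)
  rw [lintegral_two_mul_enorm_sq_add]
  exact ENNReal.mul_ne_top (by simp) (ENNReal.add_ne_top.2 ⟨hμ, hρ⟩)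

lemma secondMoment_le_secondMoment_conv (μ ρ : Measure E) [IsProbabilityMeasure μ]
    [IsProbabilityMeasure ρ] :
    secondMoment μ ≤ 2 * (secondMoment (μ.conv ρ) + secondMoment ρ) := by
  rw [← lintegral_enorm_fst_sq μ ρ, secondMoment_conv, ← lintegral_enorm_snd_sq μ ρ,
    ← lintegral_add_left (by fun_prop), ← lintegral_const_mul _ (by fun_prop)]
  refine lintegral_mono fun z => ?_
  simpa using enorm_add_sq_le (z.1 + z.2) (-z.2)

variable {μs : ℕ → ProbabilityMeasure E} {μ ρ : ProbabilityMeasure E}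

/- The integrand `‖x + y‖²` is dominated by `2 (‖x‖² + ‖y‖²)`, whose integrals converge. -/
lemma tendsto_secondMoment_conv (h : Tendsto μs atTop (𝓝 μ))
    (hμ : secondMoment (μ : Measure E) ≠ ∞) (hρ : secondMoment (ρ : Measure E) ≠ ∞)
    (hmom : Tendsto (fun n => secondMoment (μs n : Measure E)) atTop
      (𝓝 (secondMoment (μ : Measure E)))) :
    Tendsto (fun n => secondMoment ((μs n : Measure E).conv ρ)) atTop
      (𝓝 (secondMoment ((μ : Measure E).conv ρ))) := by
  have hprod : Tendsto (fun n => (μs n).prod ρ) atTop (𝓝 (μ.prod ρ)) :=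
    (ProbabilityMeasure.continuous_prod.tendsto (μ, ρ)).comp (h.prodMk_nhds tendsto_const_nhds)
  have hdom (ν : ProbabilityMeasure E) :
      ∫⁻ z, (2 * (‖z.1‖₊ ^ 2 + ‖z.2‖₊ ^ 2) : ℝ≥0) ∂(ν.prod ρ : Measure (E × E)) =
        2 * (secondMoment (ν : Measure E) + secondMoment (ρ : Measure E)) := by
    push_cast
    exact lintegral_two_mul_enorm_sq_add _ _
  have hconv (ν : ProbabilityMeasure E) :
      ∫⁻ z, (‖z.1 + z.2‖₊ ^ 2 : ℝ≥0) ∂(ν.prod ρ : Measure (E × E)) =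
        secondMoment ((ν : Measure E).conv ρ) := by
    push_cast
    exact (secondMoment_conv _ _).symm
  have hlim := tendsto_lintegral_of_le hprod
    (f := fun z => 2 * (‖z.1‖₊ ^ 2 + ‖z.2‖₊ ^ 2)) (g := fun z => ‖z.1 + z.2‖₊ ^ 2)
    (by fun_prop) (by fun_prop) (fun z => nnnorm_add_sq_le z.1 z.2)
  simp only [hdom, hconv] at hlim
  refine hlim (ENNReal.Tendsto.const_mul (hmom.add_const _) (.inr (by simp))) ?_
  exact ENNReal.mul_ne_top (by simp) (ENNReal.add_ne_top.2 ⟨hμ, hρ⟩)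

/- The integrand `‖x‖²` is dominated by `2 (‖x + y‖² + ‖y‖²)`, whose integrals converge. -/
lemma tendsto_secondMoment_of_conv (h : Tendsto μs atTop (𝓝 μ))
    (hμ : secondMoment ((μ : Measure E).conv ρ) ≠ ∞) (hρ : secondMoment (ρ : Measure E) ≠ ∞)
    (hmom : Tendsto (fun n => secondMoment ((μs n : Measure E).conv ρ)) atTop
      (𝓝 (secondMoment ((μ : Measure E).conv ρ)))) :
    Tendsto (fun n => secondMoment (μs n : Measure E)) atTop
      (𝓝 (secondMoment (μ : Measure E))) := by
  have hprod : Tendsto (fun n => (μs n).prod ρ) atTop (𝓝 (μ.prod ρ)) :=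
    (ProbabilityMeasure.continuous_prod.tendsto (μ, ρ)).comp (h.prodMk_nhds tendsto_const_nhds)
  have hdom (ν : ProbabilityMeasure E) :
      ∫⁻ z, (2 * (‖z.1 + z.2‖₊ ^ 2 + ‖z.2‖₊ ^ 2) : ℝ≥0) ∂(ν.prod ρ : Measure (E × E)) =
        2 * (secondMoment ((ν : Measure E).conv ρ) + secondMoment (ρ : Measure E)) := by
    push_cast
    rw [lintegral_const_mul _ (by fun_prop), lintegral_add_left (by fun_prop)]
    exact congrArg₂ (fun a b => 2 * (a + b)) (secondMoment_conv _ _).symm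
      (lintegral_enorm_snd_sq _ _)
  have hfst (ν : ProbabilityMeasure E) :
      ∫⁻ z, (‖z.1‖₊ ^ 2 : ℝ≥0) ∂(ν.prod ρ : Measure (E × E)) = secondMoment (ν : Measure E) := by
    push_cast
    exact lintegral_enorm_fst_sq _ _
  have hle (z : E × E) : ‖z.1‖₊ ^ 2 ≤ 2 * (‖z.1 + z.2‖₊ ^ 2 + ‖z.2‖₊ ^ 2) := by
    simpa using nnnorm_add_sq_le (z.1 + z.2) (-z.2)
  have hlim := tendsto_lintegral_of_le hprod
    (f := fun z => 2 * (‖z.1 + z.2‖₊ ^ 2 + ‖z.2‖₊ ^ 2)) (g := fun z => ‖z.1‖₊ ^ 2)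
    (by fun_prop) (by fun_prop) hle
  simp only [hdom, hfst] at hlim
  refine hlim (ENNReal.Tendsto.const_mul (hmom.add_const _) (.inr (by simp))) ?_
  exact ENNReal.mul_ne_top (by simp) (ENNReal.add_ne_top.2 ⟨hμ, hρ⟩)

end SecondMomentConv

section Mollification

variable {E : Type*} [NormedAddCommGroup E] [MeasurableSpace E] [BorelSpace E]
  [SecondCountableTopology E]

lemma conv_withDensity (κ : Measure E) [SFinite κ] [κ.IsAddRightInvariant] (μ : Measure E)
    [SFinite μ] {φ : E → ℝ≥0∞} (hφ : Measurable φ) :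
    μ.conv (κ.withDensity φ) = κ.withDensity fun x => ∫⁻ y, φ (x - y) ∂μ := by
  refine Measure.ext_of_lintegral _ fun f hf => ?_
  have hshift (y : E) : ∫⁻ x, f (y + x) ∂κ.withDensity φ = ∫⁻ x, φ (x - y) * f x ∂κ := by
    rw [lintegral_withDensity_eq_lintegral_mul _ hφ (by fun_prop),
      ← lintegral_add_right_eq_self (fun x => φ (x - y) * f x) y]
    simp [add_comm]
  rw [Measure.lintegral_conv hf, lintegral_withDensity_eq_lintegral_mul _ (by fun_prop) hf]
  simp_rw [hshift]
  rw [lintegral_lintegral_swap (by fun_prop)]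
  refine lintegral_congr fun x => ?_
  rw [lintegral_mul_const _ (by fun_prop)]
  rfl

omit [SecondCountableTopology E] in
lemma exists_mollifier [NormedSpace ℝ E] [FiniteDimensional ℝ E] (κ : Measure E)
    [κ.IsAddHaarMeasure] {r : ℝ≥0} (hr : 0 < r) :
    ∃ φ : E → ℝ≥0, Continuous φ ∧ (∃ C, ∀ x, φ x ≤ C) ∧
      IsProbabilityMeasure (κ.withDensity fun x => φ x) ∧
      secondMoment (κ.withDensity fun x => φ x) ≤ r ^ 2 := by
  let b : ContDiffBump (0 : E) := ⟨r / 2, r, by positivity, half_lt_self (by positivity)⟩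
  have hcont : Continuous fun x => (b.normed κ x).toNNReal :=
    continuous_real_toNNReal.comp b.continuous_normed
  have hprob : IsProbabilityMeasure (κ.withDensity fun x => ((b.normed κ x).toNNReal : ℝ≥0∞)) := by
    refine ⟨?_⟩
    rw [withDensity_apply _ .univ, setLIntegral_univ]
    refine (ofReal_integral_eq_lintegral_ofReal b.integrable_normed
      (ae_of_all _ b.nonneg_normed)).symm.trans ?_
    rw [b.integral_normed, ENNReal.ofReal_one]
  refine ⟨fun x => (b.normed κ x).toNNReal, hcont, ?_, hprob, ?_⟩
  · obtain ⟨C, hC⟩ := b.hasCompactSupport_normed.exists_bound_of_continuous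
      (b.continuous_normed (μ := κ))
    exact ⟨C.toNNReal, fun x => Real.toNNReal_le_toNNReal ((le_abs_self _).trans (hC x))⟩
  · have hsupp : ∀ᵐ x ∂κ.withDensity fun x => ((b.normed κ x).toNNReal : ℝ≥0∞),
        ‖x‖ₑ ^ 2 ≤ r ^ 2 := by
      rw [ae_withDensity_iff hcont.measurable.coe_nnreal_ennreal]
      refine ae_of_all _ fun x hx => pow_le_pow_left' ?_ 2
      have hball : x ∈ Function.support (b.normed κ) := fun h => hx (by simp [h])
      rw [b.support_normed_eq, mem_ball_zero_iff] at hball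
      exact ENNReal.coe_le_coe.2 hball.le
    calc secondMoment (κ.withDensity fun x => ((b.normed κ x).toNNReal : ℝ≥0∞))
      _ ≤ ∫⁻ _, r ^ 2 ∂κ.withDensity fun x => ((b.normed κ x).toNNReal : ℝ≥0∞) :=
          lintegral_mono_ae hsupp
      _ = r ^ 2 := by rw [lintegral_const, hprob.measure_univ, mul_one]

/- The densities `x ↦ ∫ φ (x - y) μₙ(dy)` converge pointwise by weak convergence. -/
lemma tendsto_W2_conv_withDensity (κ : Measure E) [SFinite κ] [κ.IsAddRightInvariant]
    {φ : E → ℝ≥0} (hφ : Continuous φ) {C : ℝ≥0} (hC : ∀ x, φ x ≤ C)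
    [hρ : IsProbabilityMeasure (κ.withDensity fun x => φ x)]
    (hρ' : secondMoment (κ.withDensity fun x => φ x) ≠ ∞)
    {μs : ℕ → ProbabilityMeasure E} {μ : ProbabilityMeasure E} (h : Tendsto μs atTop (𝓝 μ))
    (hμ : secondMoment (μ : Measure E) ≠ ∞)
    (hmom : Tendsto (fun n => secondMoment (μs n : Measure E)) atTop
      (𝓝 (secondMoment (μ : Measure E)))) :
    Tendsto (fun n => W2 ((μs n : Measure E).conv (κ.withDensity fun x => φ x))
      ((μ : Measure E).conv (κ.withDensity fun x => φ x))) atTop (𝓝 0) := by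
  have hmom' := tendsto_secondMoment_conv (ρ := ⟨_, hρ⟩) h hμ hρ' hmom
  have hfin : secondMoment ((μ : Measure E).conv (κ.withDensity fun x => φ x)) ≠ ∞ :=
    secondMoment_conv_ne_top hμ hρ'
  have hprob (ν : ProbabilityMeasure E) :
      IsProbabilityMeasure ((ν : Measure E).conv (κ.withDensity fun x => φ x)) := inferInstance
  have hmeas (ν : ProbabilityMeasure E) :
      Measurable fun x => ∫⁻ y, φ (x - y) ∂(ν : Measure E) :=
    Measurable.lintegral_prod_right (by fun_prop)
  have hconv (ν : ProbabilityMeasure E) :=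
    conv_withDensity κ (ν : Measure E) hφ.measurable.coe_nnreal_ennreal
  simp_rw [ProbabilityMeasure.coe_mk, hconv] at hmom' hfin hprob ⊢
  refine tendsto_W2_withDensity κ (fun n => hmeas (μs n)) (hmeas μ) (ae_of_all _ fun x => ?_)
    hfin hmom'
  exact tendsto_lintegral_of_le h (f := fun _ => C) (g := fun y => φ (x - y)) continuous_const
    (by fun_prop) (fun y => hC _) (by simp) (by simp)

theorem tendsto_W2_of_tendsto [NormedSpace ℝ E] [FiniteDimensional ℝ E]
    {μs : ℕ → ProbabilityMeasure E} {μ : ProbabilityMeasure E} (h : Tendsto μs atTop (𝓝 μ))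
    (hμ : secondMoment (μ : Measure E) ≠ ∞)
    (hmom : Tendsto (fun n => secondMoment (μs n : Measure E)) atTop
      (𝓝 (secondMoment (μ : Measure E)))) :
    Tendsto (fun n => W2 (μs n : Measure E) μ) atTop (𝓝 0) := by
  have : CompleteSpace E := FiniteDimensional.complete ℝ E
  refine ENNReal.tendsto_nhds_zero.2 fun δ hδ => ?_
  obtain ⟨ε, hε, hεδ⟩ := ENNReal.lt_iff_exists_nnreal_btwn.1 hδ
  rw [ENNReal.coe_pos] at hε
  let κ : Measure E := Measure.addHaar
  obtain ⟨φ, hφ, ⟨C, hC⟩, hρ, hsecond⟩ := exists_mollifier κ (r := ε / 3) (by positivity)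
  set ρ := κ.withDensity fun x => φ x
  have hW2ρ : W2 (Measure.dirac 0) ρ ≤ (ε / 3 : ℝ≥0) := by
    refine (ENNReal.pow_le_pow_left_iff two_ne_zero).1 ?_
    rw [W2_comm, W2_dirac_zero_sq]
    exact (mul_le_of_le_one_left' (by simp)).trans hsecond
  have hsmooth := tendsto_W2_conv_withDensity κ hφ hC (ne_top_of_le_ne_top (by finiteness) hsecond)
    h hμ hmom
  filter_upwards [ENNReal.tendsto_nhds_zero.1 hsmooth (ε / 3 : ℝ≥0)
    (by simpa using hε.ne')] with n hn
  refine le_trans ?_ hεδ.le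
  calc W2 (μs n : Measure E) μ
    _ ≤ W2 (μs n : Measure E) ((μs n : Measure E).conv ρ) +
          (W2 ((μs n : Measure E).conv ρ) ((μ : Measure E).conv ρ) +
            W2 ((μ : Measure E).conv ρ) μ) :=
        (W2_triangle _ _ _).trans (add_le_add_right (W2_triangle _ _ _) _)
    _ ≤ (ε / 3 : ℝ≥0) + ((ε / 3 : ℝ≥0) + (ε / 3 : ℝ≥0)) := by
        gcongr
        · exact (W2_self_conv_le _ _).trans hW2ρ
        · rw [W2_comm]
          exact (W2_self_conv_le _ _).trans hW2ρ
    _ = ε := by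
        rw [← ENNReal.coe_add, ← ENNReal.coe_add]
        congr 1
        ring

end Mollification

end Smoothing

section Sphere

open scoped Pointwise

variable {k : ℕ}

local notation "𝔼" => EuclideanSpace ℝ (Fin k)

lemma sphereMeasure_univ_le_one : sphereMeasure k .univ ≤ 1 := by
  rw [sphereMeasure, Measure.smul_apply, smul_eq_mul]
  exact ENNReal.inv_mul_le_one _

instance isFiniteMeasure_sphereMeasure : IsFiniteMeasure (sphereMeasure k) :=
  ⟨sphereMeasure_univ_le_one.trans_lt ENNReal.one_lt_top⟩

instance isOpenPosMeasure_sphereMeasure : (sphereMeasure k).IsOpenPosMeasure :=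
  Measure.isOpenPosMeasure_smul _ (ENNReal.inv_ne_zero.2 (measure_ne_top _ _))

instance isProbabilityMeasure_sphereMeasure [NeZero k] :
    IsProbabilityMeasure (sphereMeasure k) where
  measure_univ := by
    rw [sphereMeasure, Measure.smul_apply, smul_eq_mul]
    exact ENNReal.inv_mul_cancel (Measure.measure_univ_ne_zero.2 (Measure.toSphere_ne_zero _))
      (measure_ne_top _ _)

lemma map_coe_sphereMeasure_apply {s : Set 𝔼} (hs : MeasurableSet s) :
    (sphereMeasure k).map (↑) s = ((volume : Measure 𝔼).toSphere .univ)⁻¹ *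
      (k * volume (Set.Ioo (0 : ℝ) 1 • (Metric.sphere (0 : 𝔼) 1 ∩ s))) := by
  rw [Measure.map_apply measurable_subtype_coe hs, sphereMeasure, Measure.smul_apply,
    Measure.toSphere_apply' _ (measurable_subtype_coe hs), Subtype.image_preimage_coe,
    finrank_euclideanSpace_fin, smul_eq_mul]

lemma map_linearIsometryEquiv_sphereMeasure (e : 𝔼 ≃ₗᵢ[ℝ] 𝔼) :
    ((sphereMeasure k).map ((↑) : _ → 𝔼)).map e = (sphereMeasure k).map (↑) := by
  ext s hs
  have hcone : Set.Ioo (0 : ℝ) 1 • (Metric.sphere (0 : 𝔼) 1 ∩ e ⁻¹' s) =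
      e ⁻¹' (Set.Ioo (0 : ℝ) 1 • (Metric.sphere (0 : 𝔼) 1 ∩ s)) := by
    ext y
    constructor
    · rintro ⟨r, hr, x, ⟨hx, hxs⟩, rfl⟩
      exact ⟨r, hr, e x, ⟨by simpa using hx, hxs⟩, (e.map_smul r x).symm⟩
    · rintro ⟨r, hr, z, ⟨hz, hzs⟩, hy⟩
      exact ⟨r, hr, e.symm z, ⟨by simpa using hz, by simpa using hzs⟩,
        e.injective (by simpa using hy)⟩
  rw [Measure.map_apply e.continuous.measurable hs, map_coe_sphereMeasure_apply hs,
    map_coe_sphereMeasure_apply (e.continuous.measurable hs), hcone,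
    e.measurePreserving.measure_preimage_emb e.toMeasurableEquiv.measurableEmbedding]

lemma lintegral_enorm_inner_sq_eq {v w : 𝔼} (h : ‖v‖ = ‖w‖) :
    ∫⁻ θ, ‖(inner ℝ v (θ : 𝔼) : ℝ)‖ₑ ^ 2 ∂sphereMeasure k =
      ∫⁻ θ, ‖(inner ℝ w (θ : 𝔼) : ℝ)‖ₑ ^ 2 ∂sphereMeasure k := by
  obtain ⟨e, rfl⟩ : ∃ e : 𝔼 ≃ₗᵢ[ℝ] 𝔼, e v = w := ⟨_, Submodule.reflection_sub h⟩
  have hcoe (u : 𝔼) : ∫⁻ θ, ‖(inner ℝ u (θ : 𝔼) : ℝ)‖ₑ ^ 2 ∂sphereMeasure k =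
      ∫⁻ x, ‖(inner ℝ u x : ℝ)‖ₑ ^ 2 ∂(sphereMeasure k).map ((↑) : _ → 𝔼) :=
    (lintegral_map (f := fun x => ‖(inner ℝ u x : ℝ)‖ₑ ^ 2) (by fun_prop)
      measurable_subtype_coe).symm
  rw [hcoe, hcoe]
  conv_rhs => rw [← map_linearIsometryEquiv_sphereMeasure e,
    lintegral_map (by fun_prop) e.continuous.measurable]
  simp_rw [e.inner_map_map]

/- By rotation invariance `x` may be replaced by any `‖x‖ • eᵢ`; the sum over the orthonormal
basis `eᵢ` is then constant on the sphere. -/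
lemma mul_lintegral_enorm_inner_sq (x : 𝔼) :
    k * ∫⁻ θ, ‖(inner ℝ x (θ : 𝔼) : ℝ)‖ₑ ^ 2 ∂sphereMeasure k = ‖x‖ₑ ^ 2 := by
  rcases eq_or_ne k 0 with rfl | hk
  · simp [Subsingleton.elim x 0]
  have : NeZero k := ⟨hk⟩
  let b := EuclideanSpace.basisFun (Fin k) ℝ
  calc k * ∫⁻ θ, ‖(inner ℝ x (θ : 𝔼) : ℝ)‖ₑ ^ 2 ∂sphereMeasure k
    _ = ∑ i, ∫⁻ θ, ‖(inner ℝ (‖x‖ • b i) (θ : 𝔼) : ℝ)‖ₑ ^ 2 ∂sphereMeasure k := by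
        have h (i : Fin k) := lintegral_enorm_inner_sq_eq (v := ‖x‖ • b i) (w := x)
          (by simp [norm_smul])
        simp [h]
    _ = ∫⁻ θ, ∑ i, ‖(inner ℝ (‖x‖ • b i) (θ : 𝔼) : ℝ)‖ₑ ^ 2 ∂sphereMeasure k :=
        (lintegral_finsetSum _ fun i _ => by fun_prop).symm
    _ = ∫⁻ _, ‖x‖ₑ ^ 2 ∂sphereMeasure k := by
        refine lintegral_congr fun θ => ?_
        have h : ∑ i, ‖inner ℝ (b i) (θ : 𝔼)‖ₑ ^ 2 = 1 := by
          have h := b.sum_sq_norm_inner_right (θ : 𝔼)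
          simp_rw [← ofReal_norm, ← ENNReal.ofReal_pow (norm_nonneg _)]
          rw [← ENNReal.ofReal_sum_of_nonneg fun _ _ => by positivity, h]
          simp
        simp_rw [inner_smul_left, enorm_mul, mul_pow, ← Finset.mul_sum, h]
        simp
    _ = ‖x‖ₑ ^ 2 := by rw [lintegral_const, measure_univ, mul_one]

end Sphere

section Sliced

variable {k : ℕ}

local notation "𝔼" => EuclideanSpace ℝ (Fin k)

section Projection

instance isProbabilityMeasure_proj (μ : Measure 𝔼) [IsProbabilityMeasure μ] (θ : 𝔼) :
    IsProbabilityMeasure (proj μ θ) :=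
  Measure.isProbabilityMeasure_map (by fun_prop)

lemma proj_dirac (x θ : 𝔼) : proj (Measure.dirac x) θ = Measure.dirac (inner ℝ x θ) := by
  rw [proj, Measure.map_dirac' (by fun_prop)]

lemma charFun_proj (μ : Measure 𝔼) (θ : 𝔼) (t : ℝ) :
    charFun (proj μ θ) t = charFun μ (t • θ) := by
  rw [charFun_apply_real, proj, integral_map (by fun_prop) (by fun_prop), charFun_apply]
  simp_rw [inner_smul_right]
  push_cast
  rfl

lemma eq_of_proj_eq {μ ν : Measure 𝔼} [IsProbabilityMeasure μ] [IsProbabilityMeasure ν]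
    (h : ∀ θ : Metric.sphere (0 : 𝔼) 1, proj μ θ = proj ν θ) : μ = ν := by
  refine Measure.ext_of_charFun (funext fun x => ?_)
  rcases eq_or_ne x 0 with rfl | hx
  · simp
  · have hθ : ‖x‖⁻¹ • x ∈ Metric.sphere (0 : 𝔼) 1 := by simp [norm_smul, hx]
    have hsmul : ‖x‖ • ‖x‖⁻¹ • x = x := smul_inv_smul₀ (norm_ne_zero_iff.2 hx) x
    rw [← hsmul, ← charFun_proj, ← charFun_proj, h ⟨_, hθ⟩]

lemma W2_proj_le (θ : Metric.sphere (0 : 𝔼) 1) (μ ν : Measure 𝔼) :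
    W2 (proj μ θ) (proj ν θ) ≤ W2 μ ν := by
  refine W2_map_le_W2 (LipschitzWith.of_dist_le_mul fun x y => ?_) μ ν
  rw [dist_eq_norm, dist_eq_norm, ← inner_sub_left, NNReal.coe_one, one_mul]
  simpa using norm_inner_le_norm (𝕜 := ℝ) (x - y) θ

lemma tendsto_proj (μ : Measure 𝔼) [IsProbabilityMeasure μ] {θs : ℕ → 𝔼} {θ : 𝔼}
    (h : Tendsto θs atTop (𝓝 θ)) :
    Tendsto (β := ProbabilityMeasure ℝ) (fun n => ⟨proj μ (θs n), inferInstance⟩) atTop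
      (𝓝 ⟨proj μ θ, inferInstance⟩) := by
  refine ProbabilityMeasure.tendsto_iff_tendsto_charFun.2 fun t => ?_
  simp only [ProbabilityMeasure.coe_mk, charFun_proj]
  exact (continuous_charFun.tendsto (t • θ)).comp (h.const_smul t)

variable (μ ν : Measure (EuclideanSpace ℝ (Fin k))) [IsProbabilityMeasure μ]
  [IsProbabilityMeasure ν]

lemma isClosed_setOf_W2_proj_le (c : ℝ≥0∞) :
    IsClosed {θ : Metric.sphere (0 : 𝔼) 1 | W2 (proj μ θ) (proj ν θ) ≤ c} := by
  refine IsSeqClosed.isClosed fun θs θ hθs hlim => ?_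
  have hlim' : Tendsto (fun n => (θs n : 𝔼)) atTop (𝓝 θ) := tendsto_subtype_rng.1 hlim
  have hlsc := W2_le_liminf (tendsto_proj μ hlim') (tendsto_proj ν hlim')
  simp only [ProbabilityMeasure.coe_mk] at hlsc
  exact hlsc.trans (liminf_le_of_frequently_le' (Frequently.of_forall hθs))

lemma measurable_W2_proj :
    Measurable fun θ : Metric.sphere (0 : 𝔼) 1 => W2 (proj μ θ) (proj ν θ) :=
  measurable_of_Iic fun c => (isClosed_setOf_W2_proj_le μ ν c).measurableSet

end Projection

lemma SW2_sq (μ ν : Measure 𝔼) :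
    SW2 μ ν ^ 2 = ∫⁻ θ, W2 (proj μ θ) (proj ν θ) ^ 2 ∂sphereMeasure k := by
  rw [SW2, ← ENNReal.rpow_natCast, ← ENNReal.rpow_mul]
  norm_num

lemma SW2_le_W2 (μ ν : Measure 𝔼) : SW2 μ ν ≤ W2 μ ν := by
  refine (ENNReal.pow_le_pow_left_iff two_ne_zero).1 ?_
  calc SW2 μ ν ^ 2
    _ = ∫⁻ θ, W2 (proj μ θ) (proj ν θ) ^ 2 ∂sphereMeasure k := SW2_sq μ ν
    _ ≤ ∫⁻ _, W2 μ ν ^ 2 ∂sphereMeasure k :=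
        lintegral_mono fun θ => pow_le_pow_left' (W2_proj_le θ μ ν) 2
    _ ≤ W2 μ ν ^ 2 := by
        rw [lintegral_const]
        exact mul_le_of_le_one_right zero_le sphereMeasure_univ_le_one

lemma SW2_self (μ : Measure 𝔼) [IsProbabilityMeasure μ] : SW2 μ μ = 0 :=
  nonpos_iff_eq_zero.1 ((SW2_le_W2 μ μ).trans (W2_self μ).le)

lemma SW2_comm (μ ν : Measure 𝔼) : SW2 μ ν = SW2 ν μ := by
  simp_rw [SW2, W2_comm]

lemma SW2_triangle (μ ν ρ : Measure 𝔼) [IsProbabilityMeasure μ] [IsProbabilityMeasure ν]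
    [IsProbabilityMeasure ρ] : SW2 μ ρ ≤ SW2 μ ν + SW2 ν ρ := by
  have hLp := ENNReal.lintegral_Lp_add_le (measurable_W2_proj μ ν).aemeasurable
    (measurable_W2_proj ν ρ).aemeasurable (μ := sphereMeasure k) (p := 2) (by norm_num)
  simp only [ENNReal.rpow_two] at hLp
  refine le_trans ?_ hLp
  unfold SW2
  gcongr
  exact W2_triangle _ _ _

/- The directions in which the projections agree are both closed and of full measure. -/
lemma eq_of_SW2_eq_zero {μ ν : Measure 𝔼} [IsProbabilityMeasure μ] [IsProbabilityMeasure ν]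
    (h : SW2 μ ν = 0) : μ = ν := by
  have hae : ∀ᵐ θ : Metric.sphere (0 : 𝔼) 1 ∂sphereMeasure k, W2 (proj μ θ) (proj ν θ) ≤ 0 := by
    have hsq := SW2_sq μ ν
    rw [h, zero_pow two_ne_zero, eq_comm,
      lintegral_eq_zero_iff ((measurable_W2_proj μ ν).pow_const 2)] at hsq
    filter_upwards [hsq] with θ hθ
    exact (pow_eq_zero_iff two_ne_zero).1 hθ |>.le
  have huniv := (Measure.dense_of_ae hae).closure_eq
  rw [(isClosed_setOf_W2_proj_le μ ν 0).closure_eq, Set.eq_univ_iff_forall] at huniv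
  exact eq_of_proj_eq fun θ => eq_of_W2_eq_zero (nonpos_iff_eq_zero.1 (huniv θ))

lemma SW2_le_liminf {μs νs : ℕ → ProbabilityMeasure 𝔼} {μ ν : ProbabilityMeasure 𝔼}
    (hμ : Tendsto μs atTop (𝓝 μ)) (hν : Tendsto νs atTop (𝓝 ν)) :
    SW2 (μ : Measure 𝔼) ν ≤ atTop.liminf fun n => SW2 (μs n : Measure 𝔼) (νs n) := by
  have hproj (θ : 𝔼) {ρs : ℕ → ProbabilityMeasure 𝔼} {ρ : ProbabilityMeasure 𝔼}
      (h : Tendsto ρs atTop (𝓝 ρ)) :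
      Tendsto (β := ProbabilityMeasure ℝ) (fun n => ⟨proj (ρs n) θ, inferInstance⟩) atTop
        (𝓝 ⟨proj ρ θ, inferInstance⟩) :=
    ProbabilityMeasure.tendsto_map_of_tendsto_of_continuous _ _ h (by fun_prop)
  have hW2 (θ : 𝔼) : W2 (proj (μ : Measure 𝔼) θ) (proj ν θ) ^ 2 ≤
      atTop.liminf fun n => W2 (proj (μs n : Measure 𝔼) θ) (proj (νs n) θ) ^ 2 := by
    refine (pow_le_pow_left' (W2_le_liminf (hproj θ hμ) (hproj θ hν)) 2).trans_eq ?_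
    simp_rw [← ENNReal.rpow_two]
    exact OrderIso.liminf_apply (ENNReal.orderIsoRpow 2 (by norm_num))
  have hint := (lintegral_mono fun θ : Metric.sphere (0 : 𝔼) 1 => hW2 θ).trans
    (lintegral_liminf_le (μ := sphereMeasure k) fun n =>
      (measurable_W2_proj (μs n : Measure 𝔼) (νs n)).pow_const 2)
  exact ((ENNReal.orderIsoRpow (1 / 2) (by norm_num)).monotone hint).trans_eq
    (OrderIso.liminf_apply _)

/- Interchanging the integrals, both sides are integrals of `‖x‖² / 2`. -/
lemma mul_SW2_dirac_zero_sq (μ : Measure 𝔼) [IsProbabilityMeasure μ] :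
    k * SW2 μ (Measure.dirac 0) ^ 2 = 2⁻¹ * secondMoment μ := by
  have hproj (θ : 𝔼) : W2 (proj μ θ) (proj (Measure.dirac 0) θ) ^ 2 =
      2⁻¹ * ∫⁻ x, ‖(inner ℝ x θ : ℝ)‖ₑ ^ 2 ∂μ := by
    rw [proj_dirac, inner_zero_left, W2_dirac_zero_sq, secondMoment, proj,
      lintegral_map (by fun_prop) (by fun_prop)]
  calc k * SW2 μ (Measure.dirac 0) ^ 2
    _ = k * (2⁻¹ * ∫⁻ θ : Metric.sphere (0 : 𝔼) 1, ∫⁻ x, ‖(inner ℝ x (θ : 𝔼) : ℝ)‖ₑ ^ 2 ∂μ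
          ∂sphereMeasure k) := by
        simp_rw [SW2_sq, hproj]
        rw [lintegral_const_mul' _ _ (by simp)]
    _ = 2⁻¹ * (k * ∫⁻ x, ∫⁻ θ, ‖(inner ℝ x (θ : 𝔼) : ℝ)‖ₑ ^ 2 ∂sphereMeasure k ∂μ) := by
        rw [mul_left_comm, lintegral_lintegral_swap (by fun_prop)]
    _ = 2⁻¹ * secondMoment μ := by
        rw [← lintegral_const_mul' _ _ (by simp)]
        simp_rw [mul_lintegral_enorm_inner_sq]
        rfl

end Sliced

section Compactness

variable {E : Type*} [NormedAddCommGroup E] [MeasurableSpace E] [BorelSpace E]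

lemma isTightMeasureSet_of_secondMoment_le [ProperSpace E] {S : Set (Measure E)} {M : ℝ≥0∞}
    (hM : M ≠ ∞) (hS : ∀ μ ∈ S, secondMoment μ ≤ M) : IsTightMeasureSet S := by
  refine isTightMeasureSet_of_tendsto_measure_norm_gt ?_
  have hlim : Tendsto (fun r : ℝ => M / ENNReal.ofReal r ^ 2) atTop (𝓝 0) := by
    have hsq : Tendsto (fun r : ℝ => ENNReal.ofReal r ^ 2) atTop (𝓝 ∞) := by
      simpa [Function.comp_def] using
        ((ENNReal.continuous_pow 2).tendsto ∞).comp ENNReal.tendsto_ofReal_atTop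
    simpa using ENNReal.Tendsto.const_div hsq (.inr hM)
  refine tendsto_of_tendsto_of_tendsto_of_le_of_le' tendsto_const_nhds hlim
    (Eventually.of_forall fun _ => zero_le) ?_
  filter_upwards [eventually_gt_atTop 0] with r hr
  refine iSup₂_le fun μ hμ => ?_
  calc μ {x | r < ‖x‖}
    _ ≤ μ {x | ENNReal.ofReal r ^ 2 ≤ ‖x‖ₑ ^ 2} := measure_mono fun x (hx : r < ‖x‖) => by
        rw [Set.mem_ofPred_eq, ← ofReal_norm]
        gcongr
    _ ≤ secondMoment μ / ENNReal.ofReal r ^ 2 :=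
        meas_ge_le_lintegral_div (by fun_prop) (by simpa using hr) (by simp)
    _ ≤ M / ENNReal.ofReal r ^ 2 := ENNReal.div_le_div_right (hS μ hμ) _

lemma exists_subseq_tendsto_of_secondMoment_le [ProperSpace E] [SecondCountableTopology E]
    {μs : ℕ → ProbabilityMeasure E} {M : ℝ≥0∞} (hM : M ≠ ∞)
    (hμs : ∀ n, secondMoment (μs n : Measure E) ≤ M) :
    ∃ (μ : ProbabilityMeasure E) (φ : ℕ → ℕ), StrictMono φ ∧
      Tendsto (μs ∘ φ) atTop (𝓝 μ) ∧ secondMoment (μ : Measure E) ≠ ∞ := by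
  have htight :
      IsTightMeasureSet {((μ : ProbabilityMeasure E) : Measure E) | μ ∈ Set.range μs} := by
    refine isTightMeasureSet_of_secondMoment_le hM ?_
    rintro _ ⟨_, ⟨n, rfl⟩, rfl⟩
    exact hμs n
  obtain ⟨μ, -, φ, hφ, hlim⟩ := (isCompact_closure_of_isTightMeasureSet htight).tendsto_subseq
    (x := μs) fun n => subset_closure (Set.mem_range_self n)
  have hlsc := lintegral_le_liminf_of_tendsto hlim (f := fun x => ‖x‖₊ ^ 2) (by fun_prop)
  push_cast at hlsc
  refine ⟨μ, φ, hφ, hlim, ne_top_of_le_ne_top hM (hlsc.trans ?_)⟩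
  exact liminf_le_of_frequently_le' (Frequently.of_forall fun n => hμs (φ n))

end Compactness

section Convolution

variable {E : Type*} [NormedAddCommGroup E] [InnerProductSpace ℝ E] [MeasurableSpace E]
  [BorelSpace E] [SecondCountableTopology E]

lemma eq_of_conv_eq [CompleteSpace E] {μ ν ρ : Measure E} [IsFiniteMeasure μ] [IsFiniteMeasure ν]
    [IsFiniteMeasure ρ] (hρ : ∀ t, charFun ρ t ≠ 0) (h : μ.conv ρ = ν.conv ρ) : μ = ν := by
  refine Measure.ext_of_charFun (funext fun t => mul_right_cancel₀ (hρ t) ?_)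
  rw [← charFun_conv, ← charFun_conv, h]

lemma tendsto_conv [FiniteDimensional ℝ E] {μs : ℕ → ProbabilityMeasure E}
    {μ : ProbabilityMeasure E} (h : Tendsto μs atTop (𝓝 μ)) (ρ : Measure E)
    [IsProbabilityMeasure ρ] :
    Tendsto (β := ProbabilityMeasure E) (fun n => ⟨(μs n : Measure E).conv ρ, inferInstance⟩)
      atTop (𝓝 ⟨(μ : Measure E).conv ρ, inferInstance⟩) := by
  refine ProbabilityMeasure.tendsto_iff_tendsto_charFun.2 fun t => ?_
  simp only [ProbabilityMeasure.coe_mk, charFun_conv]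
  exact (ProbabilityMeasure.tendsto_iff_tendsto_charFun.1 h t).mul_const _

end Convolution

section Regularized

variable {k : ℕ} {μs : ℕ → ProbabilityMeasure (EuclideanSpace ℝ (Fin k))}

local notation "𝔼" => EuclideanSpace ℝ (Fin k)

lemma secondMoment_eq_mul_SW2_sq (μ : Measure 𝔼) [IsProbabilityMeasure μ] :
    secondMoment μ = 2 * k * SW2 μ (Measure.dirac 0) ^ 2 := by
  rw [mul_assoc, mul_SW2_dirac_zero_sq, ENNReal.mul_inv_cancel_left two_ne_zero (by simp)]

lemma tendsto_secondMoment_of_tendsto_SW2 {μs : ℕ → Measure 𝔼} {μ : Measure 𝔼}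
    [∀ n, IsProbabilityMeasure (μs n)] [IsProbabilityMeasure μ] (hμ : secondMoment μ ≠ ∞)
    (h : Tendsto (fun n => SW2 (μs n) μ) atTop (𝓝 0)) :
    Tendsto (fun n => secondMoment (μs n)) atTop (𝓝 (secondMoment μ)) := by
  have hfin : SW2 μ (Measure.dirac 0) ≠ ∞ :=
    ne_top_of_le_ne_top (W2_dirac_zero_ne_top hμ) (SW2_le_W2 _ _)
  have hlim : Tendsto (fun n => SW2 (μs n) (Measure.dirac 0)) atTop
      (𝓝 (SW2 μ (Measure.dirac 0))) := by
    refine tendsto_of_tendsto_of_tendsto_of_le_of_le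
      (g := fun n => SW2 μ (Measure.dirac 0) - SW2 (μs n) μ)
      (h := fun n => SW2 (μs n) μ + SW2 μ (Measure.dirac 0)) ?_ ?_
      (fun n => tsub_le_iff_left.2 ?_) fun n => SW2_triangle _ _ _
    · simpa using ENNReal.Tendsto.sub tendsto_const_nhds h (.inl hfin)
    · simpa using h.add_const (SW2 μ (Measure.dirac 0))
    · rw [SW2_comm (μs n) μ]
      exact SW2_triangle _ _ _
  simp_rw [secondMoment_eq_mul_SW2_sq]
  exact ENNReal.Tendsto.const_mul (((ENNReal.continuous_pow 2).tendsto _).comp hlim)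
    (.inr (by finiteness))

lemma exists_subseq_tendsto_of_SW2_conv_le {ν ρ : Measure 𝔼} [IsProbabilityMeasure ν]
    [IsProbabilityMeasure ρ] (hν : secondMoment ν ≠ ∞) (hρ : secondMoment ρ ≠ ∞)
    {M : ℝ≥0∞} (hM : M ≠ ∞) (h : ∀ n, SW2 ((μs n : Measure 𝔼).conv ρ) (ν.conv ρ) ≤ M) :
    ∃ (μ : ProbabilityMeasure 𝔼) (φ : ℕ → ℕ), StrictMono φ ∧
      Tendsto (μs ∘ φ) atTop (𝓝 μ) ∧ secondMoment (μ : Measure 𝔼) ≠ ∞ := by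
  have hfin : SW2 (ν.conv ρ) (Measure.dirac 0) ≠ ∞ :=
    ne_top_of_le_ne_top (W2_dirac_zero_ne_top (secondMoment_conv_ne_top hν hρ)) (SW2_le_W2 _ _)
  refine exists_subseq_tendsto_of_secondMoment_le
    (M := 2 * (2 * k * (M + SW2 (ν.conv ρ) (Measure.dirac 0)) ^ 2 + secondMoment ρ))
    (by finiteness) fun n => ?_
  refine (secondMoment_le_secondMoment_conv _ ρ).trans ?_
  rw [secondMoment_eq_mul_SW2_sq ((μs n : Measure 𝔼).conv ρ)]
  gcongr
  exact (SW2_triangle _ (ν.conv ρ) _).trans (add_le_add_left (h n) _)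

lemma SW2_conv_le_of_tendsto {μ : ProbabilityMeasure 𝔼} (hlim : Tendsto μs atTop (𝓝 μ))
    {ν ρ : Measure 𝔼} [IsProbabilityMeasure ν] [IsProbabilityMeasure ρ] {c : ℝ≥0∞}
    (hc : ∀ᶠ n in atTop, SW2 ((μs n : Measure 𝔼).conv ρ) (ν.conv ρ) ≤ c) :
    SW2 ((μ : Measure 𝔼).conv ρ) (ν.conv ρ) ≤ c :=
  (SW2_le_liminf (ν := ⟨ν.conv ρ, inferInstance⟩) (tendsto_conv hlim ρ)
    tendsto_const_nhds).trans (liminf_le_of_frequently_le' hc.frequently)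

lemma SW2_conv_le_W2 (μ ν ρ : Measure 𝔼) [IsProbabilityMeasure ρ] :
    SW2 (μ.conv ρ) (ν.conv ρ) ≤ W2 μ ν :=
  (SW2_le_W2 _ _).trans (W2_conv_le _ _ _)

lemma eq_of_SW2_conv_eq_zero {μ ν ρ : Measure 𝔼} [IsProbabilityMeasure μ]
    [IsProbabilityMeasure ν] [IsProbabilityMeasure ρ] (hρ : ∀ t, charFun ρ t ≠ 0)
    (h : SW2 (μ.conv ρ) (ν.conv ρ) = 0) : μ = ν :=
  eq_of_conv_eq hρ (eq_of_SW2_eq_zero h)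

lemma tendsto_W2_of_tendsto_of_tendsto_SW2_conv {μ ρ : ProbabilityMeasure 𝔼}
    (hμ : secondMoment (μ : Measure 𝔼) ≠ ∞) (hρ : secondMoment (ρ : Measure 𝔼) ≠ ∞)
    (hlim : Tendsto μs atTop (𝓝 μ))
    (h : Tendsto (fun n => SW2 ((μs n : Measure 𝔼).conv ρ) ((μ : Measure 𝔼).conv ρ)) atTop
      (𝓝 0)) :
    Tendsto (fun n => W2 (μs n : Measure 𝔼) μ) atTop (𝓝 0) := by
  have hconv : secondMoment ((μ : Measure 𝔼).conv ρ) ≠ ∞ := secondMoment_conv_ne_top hμ hρ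
  exact tendsto_W2_of_tendsto hlim hμ
    (tendsto_secondMoment_of_conv hlim hconv hρ (tendsto_secondMoment_of_tendsto_SW2 hconv h))

theorem tendsto_W2_of_tendsto_SW2_conv {μ ρ : ProbabilityMeasure 𝔼}
    (hμ : secondMoment (μ : Measure 𝔼) ≠ ∞) (hρ : secondMoment (ρ : Measure 𝔼) ≠ ∞)
    (hchar : ∀ t, charFun (ρ : Measure 𝔼) t ≠ 0)
    (h : Tendsto (fun n => SW2 ((μs n : Measure 𝔼).conv ρ) ((μ : Measure 𝔼).conv ρ)) atTop
      (𝓝 0)) :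
    Tendsto (fun n => W2 (μs n : Measure 𝔼) μ) atTop (𝓝 0) := by
  obtain ⟨N, hN⟩ := eventually_atTop.1 (h.eventually_le_const zero_lt_one)
  refine tendsto_of_subseq_tendsto fun ns hns => ?_
  obtain ⟨N', hN'⟩ := eventually_atTop.1 (hns.eventually_ge_atTop N)
  obtain ⟨μ', φ, hφ, hlim, -⟩ := exists_subseq_tendsto_of_SW2_conv_le
    (μs := fun n => μs (ns (n + N'))) hμ hρ ENNReal.one_ne_top fun n => hN _ (hN' _ le_add_self)
  have hS := h.comp (hns.comp ((tendsto_add_atTop_nat N').comp hφ.tendsto_atTop))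
  obtain rfl : μ' = μ := by
    refine ProbabilityMeasure.toMeasure_injective
      (eq_of_SW2_conv_eq_zero hchar (nonpos_iff_eq_zero.1 ?_))
    exact le_of_forall_gt_imp_ge_of_dense fun c hc =>
      SW2_conv_le_of_tendsto hlim (hS.eventually_le_const hc)
  exact ⟨fun n => φ n + N', tendsto_W2_of_tendsto_of_tendsto_SW2_conv hμ hρ hlim hS⟩

theorem exists_tendsto_SW2_conv {ρ : Measure 𝔼} [IsProbabilityMeasure ρ]
    (hμs : ∀ n, secondMoment (μs n : Measure 𝔼) ≠ ∞) (hρ : secondMoment ρ ≠ ∞)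
    (h : ∀ ε : ℝ≥0∞, 0 < ε → ∃ N, ∀ m ≥ N, ∀ n ≥ N,
      SW2 ((μs m : Measure 𝔼).conv ρ) ((μs n : Measure 𝔼).conv ρ) < ε) :
    ∃ μ : ProbabilityMeasure 𝔼, secondMoment (μ : Measure 𝔼) ≠ ∞ ∧
      Tendsto (fun n => SW2 ((μs n : Measure 𝔼).conv ρ) ((μ : Measure 𝔼).conv ρ)) atTop
        (𝓝 0) := by
  obtain ⟨N, hN⟩ := h 1 zero_lt_one
  obtain ⟨μ, φ, hφ, hlim, hμ⟩ := exists_subseq_tendsto_of_SW2_conv_le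
    (μs := fun n => μs (n + N)) (hμs N) hρ ENNReal.one_ne_top
    fun n => (hN _ le_add_self _ le_rfl).le
  refine ⟨μ, hμ, ENNReal.tendsto_nhds_zero.2 fun ε hε => ?_⟩
  obtain ⟨K, hK⟩ := h ε hε
  filter_upwards [eventually_ge_atTop K] with n hn
  rw [SW2_comm]
  refine SW2_conv_le_of_tendsto hlim ?_
  filter_upwards [eventually_ge_atTop K] with m hm
  exact (hK _ ((hm.trans (hφ.id_le m)).trans (Nat.le_add_right _ _)) _ hn).le

end Regularized

section MetricStructures

lemma continuous_of_tendsto_edist {X Y : Type*} [PseudoEMetricSpace X] [PseudoEMetricSpace Y]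
    {f : X → Y} (h : ∀ (u : ℕ → X) (x : X), Tendsto (fun n => edist (u n) x) atTop (𝓝 0) →
      Tendsto (fun n => edist (f (u n)) (f x)) atTop (𝓝 0)) : Continuous f :=
  SeqContinuous.continuous fun u x hu =>
    tendsto_iff_edist_tendsto_0.2 (h u x (tendsto_iff_edist_tendsto_0.1 hu))

lemma toTopologicalSpace_eq_of_tendsto_edist_iff {X : Type*} (m m' : PseudoEMetricSpace X)
    (h : ∀ (u : ℕ → X) (x : X), Tendsto (fun n => m.edist (u n) x) atTop (𝓝 0) ↔
      Tendsto (fun n => m'.edist (u n) x) atTop (𝓝 0)) :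
    m.toUniformSpace.toTopologicalSpace = m'.toUniformSpace.toTopologicalSpace :=
  le_antisymm
    (continuous_id_iff_le.1 (@continuous_of_tendsto_edist X X m m' id fun u x => (h u x).1))
    (continuous_id_iff_le.1 (@continuous_of_tendsto_edist X X m' m id fun u x => (h u x).2))

variable {k : ℕ}

local notation "𝔼" => EuclideanSpace ℝ (Fin k)

instance P2.isProbabilityMeasure (μ : P2 k) : IsProbabilityMeasure μ.toMeasure := μ.isProb

lemma P2.secondMoment_ne_top (μ : P2 k) : secondMoment μ.toMeasure ≠ ∞ := by
  simpa only [secondMoment, ENNReal.ofReal_pow (norm_nonneg _), ofReal_norm] using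
    μ.finite_moment.ne

lemma P2.exists_toMeasure_eq {μ : Measure 𝔼} [IsProbabilityMeasure μ] (h : secondMoment μ ≠ ∞) :
    ∃ ν : P2 k, ν.toMeasure = μ :=
  ⟨⟨μ, inferInstance, by
    simpa only [ENNReal.ofReal_pow (norm_nonneg _), ofReal_norm] using! h.lt_top⟩, rfl⟩

lemma P2.toMeasure_injective : Function.Injective (P2.toMeasure (k := k)) := by
  rintro ⟨μ, _, _⟩ ⟨ν, _, _⟩ h
  cases h
  rfl

/-- The metric `W2` on `P2 k`, as a structure to be compared with `slicedMetric`. -/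
noncomputable abbrev wassersteinMetric (k : ℕ) : MetricSpace (P2 k) :=
  letI : EMetricSpace (P2 k) :=
    { edist := fun μ ν => W2 μ.toMeasure ν.toMeasure
      edist_self := fun _ => W2_self _
      edist_comm := fun _ _ => W2_comm _ _
      edist_triangle := fun _ _ _ => W2_triangle _ _ _
      eq_of_edist_eq_zero := fun h => P2.toMeasure_injective (eq_of_W2_eq_zero h) }
  EMetricSpace.toMetricSpace fun μ ν => W2_ne_top μ.secondMoment_ne_top ν.secondMoment_ne_top

variable {ρ : ProbabilityMeasure (EuclideanSpace ℝ (Fin k))}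

/-- The metric on `P2 k` given by the distance `SW2` of the convolutions with `ρ`. The hypothesis
on `ρ` makes convolution with it injective, so that points at distance zero agree. -/
noncomputable abbrev slicedMetric (hchar : ∀ t, charFun (ρ : Measure 𝔼) t ≠ 0) :
    MetricSpace (P2 k) :=
  letI : EMetricSpace (P2 k) :=
    { edist := fun μ ν => SW2 (μ.toMeasure.conv ρ) (ν.toMeasure.conv ρ)
      edist_self := fun _ => SW2_self _
      edist_comm := fun _ _ => SW2_comm _ _
      edist_triangle := fun _ _ _ => SW2_triangle _ _ _
      eq_of_edist_eq_zero := fun h => P2.toMeasure_injective (eq_of_SW2_conv_eq_zero hchar h) }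
  EMetricSpace.toMetricSpace fun μ ν => ne_top_of_le_ne_top
    (W2_ne_top μ.secondMoment_ne_top ν.secondMoment_ne_top) (SW2_conv_le_W2 _ _ _)

lemma completeSpace_slicedMetric (hρ : secondMoment (ρ : Measure 𝔼) ≠ ∞)
    (hchar : ∀ t, charFun (ρ : Measure 𝔼) t ≠ 0) :
    @CompleteSpace (P2 k) (slicedMetric hchar).toUniformSpace := by
  let := slicedMetric hchar
  refine EMetric.complete_of_cauchySeq_tendsto fun u hu => ?_
  obtain ⟨μ, hμ, hlim⟩ := exists_tendsto_SW2_conv (μs := fun n => ⟨(u n).toMeasure, inferInstance⟩)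
    (fun n => (u n).secondMoment_ne_top) hρ (EMetric.cauchySeq_iff.1 hu)
  obtain ⟨ν, hν⟩ := P2.exists_toMeasure_eq hμ
  rw [← hν] at hlim
  exact ⟨ν, tendsto_iff_edist_tendsto_0.2 hlim⟩

lemma toTopologicalSpace_slicedMetric (hρ : secondMoment (ρ : Measure 𝔼) ≠ ∞)
    (hchar : ∀ t, charFun (ρ : Measure 𝔼) t ≠ 0) :
    (slicedMetric hchar).toUniformSpace.toTopologicalSpace =
      (wassersteinMetric k).toUniformSpace.toTopologicalSpace :=
  toTopologicalSpace_eq_of_tendsto_edist_iff _ _ fun u μ =>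
    ⟨tendsto_W2_of_tendsto_SW2_conv (μs := fun n => ⟨(u n).toMeasure, inferInstance⟩)
      (μ := ⟨μ.toMeasure, inferInstance⟩) μ.secondMoment_ne_top hρ hchar,
    fun h => tendsto_of_tendsto_of_tendsto_of_le_of_le tendsto_const_nhds h
      (fun _ => zero_le) fun _ => SW2_conv_le_W2 _ _ _⟩

theorem lemma1_general (hρ : secondMoment (ρ : Measure 𝔼) ≠ ∞)
    (hchar : ∀ t, charFun (ρ : Measure 𝔼) t ≠ 0) :
    ∃ mW mS : MetricSpace (P2 k),
      (∀ μ ν : P2 k, mW.edist μ ν = W2 μ.toMeasure ν.toMeasure) ∧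
      (∀ μ ν : P2 k, mS.edist μ ν = SW2 (μ.toMeasure.conv ρ) (ν.toMeasure.conv ρ)) ∧
      @CompleteSpace (P2 k) mS.toUniformSpace ∧
      mS.toUniformSpace.toTopologicalSpace = mW.toUniformSpace.toTopologicalSpace :=
  ⟨wassersteinMetric k, slicedMetric hchar, fun _ _ => rfl, fun _ _ => rfl,
    completeSpace_slicedMetric hρ hchar, toTopologicalSpace_slicedMetric hρ hchar⟩

end MetricStructures

section Gaussian

variable {k : ℕ} {σ : ℝ}

instance isGaussian_gaussianN : IsGaussian (gaussianN k σ) := isGaussian_multivariateGaussian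

lemma secondMoment_gaussianN_ne_top : secondMoment (gaussianN k σ) ≠ ∞ := by
  have h := lintegral_rpow_enorm_lt_top_of_eLpNorm_lt_top two_ne_zero ENNReal.ofNat_ne_top
    (IsGaussian.memLp_two_id (μ := gaussianN k σ)).eLpNorm_lt_top
  simpa only [ENNReal.toReal_ofNat, ENNReal.rpow_two] using! h.ne

lemma charFun_gaussianN_ne_zero (t : EuclideanSpace ℝ (Fin k)) :
    charFun (gaussianN k σ) t ≠ 0 := by
  rw [gaussianN, charFun_multivariateGaussian (Matrix.PosSemidef.one.smul (sq_nonneg σ))]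
  exact Complex.exp_ne_zero _

end Gaussian

/- The distances are `[0, ∞]`-valued; a `MetricSpace` whose extended distance is the given
function is a genuine metric, so finiteness on `P2 k` is part of the claim. -/
theorem lemma1 (k : ℕ) (σ : ℝ) (hσ : 0 ≤ σ) :
    ∃ mW mS : MetricSpace (P2 k),
      (∀ μ ν : P2 k, mW.edist μ ν = W2 μ.toMeasure ν.toMeasure) ∧
      (∀ μ ν : P2 k, mS.edist μ ν = SW2reg σ μ.toMeasure ν.toMeasure) ∧
      @CompleteSpace (P2 k) mS.toUniformSpace ∧
      mS.toUniformSpace.toTopologicalSpace = mW.toUniformSpace.toTopologicalSpace :=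
  lemma1_general (ρ := ⟨gaussianN k σ, inferInstance⟩) secondMoment_gaussianN_ne_top
    charFun_gaussianN_ne_zero
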